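/- Let $G$ be a (finite-dimensional, real) Lie group, $H\subset G$ a closed subgroup, $M=G/H$ the smooth coset space with projection $\pi:G\to G/H$ and origin $o=eH$, and let $F:TM\to[0,\infty)$ be a $G$-invariant Finsler metric: $F$ is continuous, smooth and positive on $TM\setminus 0$, positively $1$-homogeneous on each tangent space, and its fundamental tensor $g_y(u,v)=\tfrac12\tfrac{\partial^2}{\partial s\partial t}|_{s=t=0}F^2(y+su+tv)$ is positive definite for every $y\ne0$. Let $\mathfrak g=\mathfrak h+\mathfrak m$ be any linear direct sum decomposition, where $\mathfrak g=\mathrm{Lie}(G)$ (with the bracket of left invariant vector fields), $\mathfrak h=\mathrm{Lie}(H)$ and $\mathfrak m$ is a linear complement, not necessarily $\mathrm{Ad}(H)$-invariant. Write $[\cdot,\cdot]_{\mathfrak m}$ for the $\mathfrak m$-component of the bracket, and identify $\mathfrak m$ with $T_o(G/H)$ by $\pi_*$. In standard local coordinates $(x^i,y^j)$ on $TM$ put $\mathbf G^i=\tfrac14g^{il}([F^2]_{x^ky^l}y^k-[F^2]_{x^l})$ and $\mathbf N^i_j=\partial\mathbf G^i/\partial y^j$. A geodesic is a smooth curve $c$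 with nowhere vanishing velocity and $\ddot c^i+2\mathbf G^i(c,\dot c)=0$; a smooth vector field $X(t)$ along $c$ is linearly parallel if $\dot X^i+\mathbf N^i_j(c,\dot c)X^j=0$. The Cartan tensor is $\mathbf C_y(u,v,w)=\tfrac14[F^2]_{y^iy^jy^k}u^iv^jw^k$, and $\mathbf C_y(w_1,w_2,w_3,w_4)=\tfrac{d}{dt}|_{t=0}\mathbf C_{y+tw_4}(w_1,w_2,w_3)$. The Landsberg curvature is $\mathbf L_y(u,v,w)=\tfrac{d}{dt}|_{t=0}\mathbf C_{\dot c(t)}(U(t),V(t),W(t))$, where $c$ is the geodesic with $\dot c(0)=y$ and $U,V,W$ are linearly parallel along $c$ with $U(0)=u$, $V(0)=v$, $W(0)=w$. For $y\in\mathfrak m\setminus\{0\}$ let $c$ be the geodesic with $c(0)=o$, $\dot c(0)=y$, and let $\bar c$ be the unique smooth curve in $G$, defined near $t=0$, with $\bar c(0)=e$, $c(t)=\bar c(t)\cdot o$ and $y(t):=(L_{\bar c(t)^{-1}})_*\dot{\bar c}(t)\in\mathfrak m$. The spray vector field $\eta:\mathfrak m\setminus\{0\}\to\mathfrak m$ is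 $\eta(y)=-\tfrac{d}{dt}|_{t=0}y(t)$, and the connection operator is $N(y,v)=\tfrac12\tfrac{d}{dt}|_{t=0}\eta(y+tv)-\tfrac12[y,v]_{\mathfrak m}$. Then for all $y\in\mathfrak m\setminus\{0\}$ and $w\in\mathfrak m$, $$\mathbf L_y(w,w,w)=3\,\mathbf C_y\bigl(w,w,[w,y]_{\mathfrak m}-N(y,w)\bigr)-\mathbf C_y\bigl(w,w,w,\eta(y)\bigr),$$ where the Cartan tensors on the right are those of the Minkowski norm $F(o,\cdot)$ on $\mathfrak m=T_o(G/H)$. -/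

import Mathlib

open Filter Topology
open scoped Manifold ContDiff

noncomputable section

/-! ### Minkowski norms: fundamental tensor and Cartan tensors -/

/-- The fundamental tensor `g_y(u, v) = ½ ∂²/∂s∂t Φ²(y + s u + t v)` at `s = t = 0`. -/
def fundamentalTensor {V : Type*} [AddCommGroup V] [Module ℝ V] (Φ : V → ℝ) (y u v : V) : ℝ :=
  (1 / 2) * lineDeriv ℝ (fun y' => lineDeriv ℝ (fun y'' => Φ y'' ^ 2) y' v) y u

/-- The Cartan tensor `C_y(u, v, w) = ¼ [Φ²]_{y^i y^j y^k} u^i v^j w^k`. -/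
def cartanTensor {V : Type*} [AddCommGroup V] [Module ℝ V] (Φ : V → ℝ) (y u v w : V) : ℝ :=
  (1 / 4) * lineDeriv ℝ (fun y' =>
    lineDeriv ℝ (fun y'' => lineDeriv ℝ (fun y₃ => Φ y₃ ^ 2) y'' w) y' v) y u

/-- The Cartan tensor of order four,
`C_y(w₁, w₂, w₃, w₄) = d/dt|_{t=0} C_{y + t w₄}(w₁, w₂, w₃)`. -/
def cartanTensor₄ {V : Type*} [AddCommGroup V] [Module ℝ V] (Φ : V → ℝ)
    (y w₁ w₂ w₃ w₄ : V) : ℝ :=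
  deriv (fun t : ℝ => cartanTensor Φ (y + t • w₄) w₁ w₂ w₃) 0

/-! ### Geodesic spray of a Finsler function in local coordinates

`L p v` is the value of the Finsler function at the point with coordinates `x = p`, `y = v`. -/

/-- The coordinate vector `∂_{x^i}`. -/
abbrev coordVec {n : ℕ} (i : Fin n) : EuclideanSpace ℝ (Fin n) := EuclideanSpace.single i 1

/-- The matrix `g_{ij} = [½ L²]_{y^i y^j}`. -/
def fundamentalMatrix {n : ℕ} (L : EuclideanSpace ℝ (Fin n) → EuclideanSpace ℝ (Fin n) → ℝ)
    (p v : EuclideanSpace ℝ (Fin n)) : Matrix (Fin n) (Fin n) ℝ :=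
  Matrix.of fun i j => fundamentalTensor (L p) v (coordVec i) (coordVec j)

/-- The spray coefficients `G^i = ¼ g^{il} ([L²]_{x^k y^l} y^k - [L²]_{x^l})`. -/
def sprayCoeff {n : ℕ} (L : EuclideanSpace ℝ (Fin n) → EuclideanSpace ℝ (Fin n) → ℝ)
    (p v : EuclideanSpace ℝ (Fin n)) (i : Fin n) : ℝ :=
  (1 / 4) * ∑ l, (fundamentalMatrix L p v)⁻¹ i l *
    ((∑ k, lineDeriv ℝ (fun p' => lineDeriv ℝ (fun v' => L p' v' ^ 2) v (coordVec l))
        p (coordVec k) * v k)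
      - lineDeriv ℝ (fun p' => L p' v ^ 2) p (coordVec l))

/-- The connection coefficients `N^i_j = ∂ G^i / ∂ y^j`. -/
def connectionCoeff {n : ℕ} (L : EuclideanSpace ℝ (Fin n) → EuclideanSpace ℝ (Fin n) → ℝ)
    (p v : EuclideanSpace ℝ (Fin n)) (i j : Fin n) : ℝ :=
  lineDeriv ℝ (fun v' => sprayCoeff L p v' i) v (coordVec j)

/-! ### Finsler metrics on manifolds -/

section Finsler

variable {n : ℕ} {M : Type*} [TopologicalSpace M] [ChartedSpace (EuclideanSpace ℝ (Fin n)) M]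

/-- The restriction of `F : TM → ℝ` to the tangent space `T_x M`. -/
def fiberNorm (F : TangentBundle (𝓡 n) M → ℝ) (x : M) : TangentSpace (𝓡 n) x → ℝ :=
  fun y => F ⟨x, y⟩

/-- Finsler metrics on the smooth manifold `M`. -/
structure IsFinslerMetric [IsManifold (𝓡 n) ∞ M] (F : TangentBundle (𝓡 n) M → ℝ) : Prop where
  nonneg : ∀ p, 0 ≤ F p
  continuous : Continuous F
  smooth : ContMDiffOn (𝓡 n).tangent 𝓘(ℝ, ℝ) ∞ F {p | p.2 ≠ 0}
  pos : ∀ (x : M) (y : TangentSpace (𝓡 n) x), y ≠ 0 → 0 < F ⟨x, y⟩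
  homogeneous : ∀ (x : M) (y : TangentSpace (𝓡 n) x) (a : ℝ), 0 ≤ a →
    F ⟨x, a • y⟩ = a * F ⟨x, y⟩
  strongly_convex : ∀ (x : M) (y : TangentSpace (𝓡 n) x), y ≠ 0 →
    ∀ u : TangentSpace (𝓡 n) x, u ≠ 0 → 0 < fundamentalTensor (fiberNorm F x) y u u

/-- `F` in the standard local coordinates `(x, y)` on `TM` induced by the chart of `M`
around `x₀`. -/
def localRep (F : TangentBundle (𝓡 n) M → ℝ) (x₀ : M) (p v : EuclideanSpace ℝ (Fin n)) : ℝ :=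
  F ⟨(extChartAt (𝓡 n) x₀).symm p, mfderiv (𝓡 n) (𝓡 n) (extChartAt (𝓡 n) x₀).symm p v⟩

/-- The curve `c` in the coordinates around `x₀`. -/
def localCurve (x₀ : M) (c : ℝ → M) (t : ℝ) : EuclideanSpace ℝ (Fin n) :=
  extChartAt (𝓡 n) x₀ (c t)

/-- The coordinates of a vector field along the curve `c`, for the chart around `x₀`. -/
def localField (x₀ : M) (c : ℝ → M) (X : ∀ t, TangentSpace (𝓡 n) (c t)) (t : ℝ) :
    EuclideanSpace ℝ (Fin n) :=
  mfderiv (𝓡 n) (𝓡 n) (extChartAt (𝓡 n) x₀) (c t) (X t)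

/-- Near the time `t₀`, the curve `c` is a geodesic of `F`: it is smooth, its velocity does not
vanish, and `c̈^i + 2 G^i(c, ċ) = 0` in local coordinates around `c t₀`. -/
def IsGeodesicAt (F : TangentBundle (𝓡 n) M → ℝ) (c : ℝ → M) (t₀ : ℝ) : Prop :=
  (∀ᶠ t in 𝓝 t₀, ContMDiffAt 𝓘(ℝ, ℝ) (𝓡 n) ∞ c t) ∧
  (∀ᶠ t in 𝓝 t₀, deriv (localCurve (n := n) (c t₀) c) t ≠ 0) ∧
  ∀ᶠ t in 𝓝 t₀, ∀ i : Fin n,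
    deriv (deriv (localCurve (n := n) (c t₀) c)) t i
      + 2 * sprayCoeff (localRep F (c t₀)) (localCurve (c t₀) c t)
          (deriv (localCurve (c t₀) c) t) i = 0

/-- Near the time `t₀`, the vector field `X` along `c` is smooth and linearly parallel:
`dX^i/dt + N^i_j(c, ċ) X^j = 0` in local coordinates around `c t₀`. -/
def IsLinearlyParallelAt (F : TangentBundle (𝓡 n) M → ℝ) (c : ℝ → M)
    (X : ∀ t, TangentSpace (𝓡 n) (c t)) (t₀ : ℝ) : Prop :=
  (∀ᶠ t in 𝓝 t₀, ContDiffAt ℝ ∞ (localField (c t₀) c X) t) ∧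
  ∀ᶠ t in 𝓝 t₀, ∀ i : Fin n,
    deriv (localField (c t₀) c X) t i
      + ∑ j, connectionCoeff (localRep F (c t₀)) (localCurve (c t₀) c t)
          (deriv (localCurve (c t₀) c) t) i j * localField (c t₀) c X t j = 0

/-- The velocity `ċ(t)`. -/
def curveVelocity (c : ℝ → M) (t : ℝ) : TangentSpace (𝓡 n) (c t) :=
  mfderiv 𝓘(ℝ, ℝ) (𝓡 n) c t (1 : ℝ)

/-- `ℓ` is the derivative at `0` of `C_{ċ(t)}(U(t), V(t), W(t))`, where `c` is a geodesic with
`c(0) = x`, `ċ(0) = y`, and `U`, `V`, `W` are linearly parallel along `c` with initial values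
`u`, `v`, `w`. -/
def IsLandsbergValue (F : TangentBundle (𝓡 n) M → ℝ) (x : M)
    (y u v w : TangentSpace (𝓡 n) x) (ℓ : ℝ) : Prop :=
  ∃ (c : ℝ → M) (U V W : ∀ t, TangentSpace (𝓡 n) (c t)),
    IsGeodesicAt F c 0 ∧
    (⟨c 0, curveVelocity c 0⟩ : TangentBundle (𝓡 n) M) = ⟨x, y⟩ ∧
    IsLinearlyParallelAt F c U 0 ∧ (⟨c 0, U 0⟩ : TangentBundle (𝓡 n) M) = ⟨x, u⟩ ∧
    IsLinearlyParallelAt F c V 0 ∧ (⟨c 0, V 0⟩ : TangentBundle (𝓡 n) M) = ⟨x, v⟩ ∧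
    IsLinearlyParallelAt F c W 0 ∧ (⟨c 0, W 0⟩ : TangentBundle (𝓡 n) M) = ⟨x, w⟩ ∧
    HasDerivAt
      (fun t => cartanTensor (fiberNorm F (c t)) (curveVelocity c t) (U t) (V t) (W t)) ℓ 0

/-- The Landsberg curvature `L_y(u, v, w)` for `y, u, v, w ∈ T_x M`, `y ≠ 0`: the value `ℓ` with
`IsLandsbergValue F x y u v w ℓ`. -/
def landsbergCurvature (F : TangentBundle (𝓡 n) M → ℝ) (x : M)
    (y u v w : TangentSpace (𝓡 n) x) : ℝ :=
  Classical.epsilon (IsLandsbergValue F x y u v w)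

end Finsler

/-! ### Coset spaces -/

section Coset

variable {E : Type*} [NormedAddCommGroup E] [NormedSpace ℝ E]
  {G : Type*} [Group G] [TopologicalSpace G] [ChartedSpace E G]

/-- The Lie algebra `𝔥 = T_e H` of a closed subgroup `H` of `G`, formed by the velocities at `e`
of the smooth curves of `G` which lie in `H`. (These velocities form a linear subspace already,
so taking the span adds nothing.) -/
def subgroupLieAlgebra (H : Subgroup G) : Submodule ℝ (GroupLieAlgebra 𝓘(ℝ, E) G) :=
  Submodule.span ℝ {v | ∃ γ : ℝ → G,
    (∀ᶠ t in 𝓝 (0 : ℝ), ContMDiffAt 𝓘(ℝ, ℝ) 𝓘(ℝ, E) ∞ γ t) ∧ (∀ᶠ t in 𝓝 (0 : ℝ), γ t ∈ H) ∧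
    (⟨γ 0, mfderiv 𝓘(ℝ, ℝ) 𝓘(ℝ, E) γ 0 (1 : ℝ)⟩ : TangentBundle 𝓘(ℝ, E) G) = ⟨1, v⟩}

variable (H : Subgroup G) {n : ℕ} [ChartedSpace (EuclideanSpace ℝ (Fin n)) (G ⧸ H)]

/-- The projection `π : G → G/H`, `π g = g • o`. -/
abbrev cosetProj (H : Subgroup G) : G → G ⧸ H := fun g => (g : G ⧸ H)

/-- The origin `o = eH`. -/
abbrev cosetOrigin (H : Subgroup G) : G ⧸ H := cosetProj H 1

variable {H}

/-- The identification `v ↦ π_* v` of `𝔪` with `T_o(G/H)`. -/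
def toTangentOrigin (𝔪 : Submodule ℝ (GroupLieAlgebra 𝓘(ℝ, E) G)) (v : 𝔪) :
    TangentSpace (𝓡 n) (cosetOrigin H) :=
  mfderiv 𝓘(ℝ, E) (𝓡 n) (cosetProj H) 1 (v : GroupLieAlgebra 𝓘(ℝ, E) G)

/-- The Minkowski norm `F(o, ·)` on `𝔪 = T_o(G/H)`. -/
def originNorm (F : TangentBundle (𝓡 n) (G ⧸ H) → ℝ)
    (𝔪 : Submodule ℝ (GroupLieAlgebra 𝓘(ℝ, E) G)) : 𝔪 → ℝ :=
  fun v => fiberNorm F (cosetOrigin H) (toTangentOrigin 𝔪 v)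

/-- The metric `F` is invariant under the left translations of `G` on `G/H`. -/
def IsInvariantMetric (F : TangentBundle (𝓡 n) (G ⧸ H) → ℝ) : Prop :=
  ∀ (g : G) (x : G ⧸ H) (v : TangentSpace (𝓡 n) x),
    F ⟨g • x, mfderiv (𝓡 n) (𝓡 n) (fun x' : G ⧸ H => g • x') x v⟩ = F ⟨x, v⟩

/-- Near `t = 0`, `c'` is the smooth curve in `G` with `c' 0 = e`, lifting the curve `c` of `G/H`,
and with `(L_{c'(t)⁻¹})_* (d/dt c'(t)) = u(t) ∈ 𝔪`. -/
def IsLiftAtZero (𝔪 : Submodule ℝ (GroupLieAlgebra 𝓘(ℝ, E) G))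
    (c : ℝ → G ⧸ H) (c' : ℝ → G) (u : ℝ → 𝔪) : Prop :=
  (∀ᶠ t in 𝓝 (0 : ℝ), ContMDiffAt 𝓘(ℝ, ℝ) 𝓘(ℝ, E) ∞ c' t) ∧
  c' 0 = 1 ∧
  (∀ᶠ t in 𝓝 (0 : ℝ), c t = cosetProj H (c' t)) ∧
  ∀ᶠ t in 𝓝 (0 : ℝ), mfderiv 𝓘(ℝ, ℝ) 𝓘(ℝ, E) c' t (1 : ℝ)
    = mulInvariantVectorField (u t : GroupLieAlgebra 𝓘(ℝ, E) G) (c' t)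

/-- `e = - d/dt|_{t=0} y(t)`, where `y(t) = (L_{c'(t)⁻¹})_* (d/dt c'(t)) ∈ 𝔪` for the lift `c'` of
the geodesic `c` with `c 0 = o`, `ċ(0) = y`. -/
def IsSprayVector (F : TangentBundle (𝓡 n) (G ⧸ H) → ℝ)
    (𝔪 : Submodule ℝ (GroupLieAlgebra 𝓘(ℝ, E) G)) (y e : 𝔪) : Prop :=
  ∃ (c : ℝ → G ⧸ H) (c' : ℝ → G) (yt : ℝ → 𝔪),
    IsGeodesicAt F c 0 ∧
    (⟨c 0, curveVelocity c 0⟩ : TangentBundle (𝓡 n) (G ⧸ H))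
      = ⟨cosetOrigin H, toTangentOrigin 𝔪 y⟩ ∧
    IsLiftAtZero 𝔪 c c' yt ∧ HasDerivAt yt (-e) 0

/-- The spray vector field `η : 𝔪 \ {0} → 𝔪`: the vector `e` with `IsSprayVector F 𝔪 y e`. -/
def sprayVectorField (F : TangentBundle (𝓡 n) (G ⧸ H) → ℝ)
    (𝔪 : Submodule ℝ (GroupLieAlgebra 𝓘(ℝ, E) G)) (y : 𝔪) : 𝔪 :=
  Classical.epsilon (IsSprayVector F 𝔪 y)

/-- The operation `[u, v]_𝔪`, for the decomposition `𝔤 = 𝔥 + 𝔪`. -/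
def bracketProj {𝔪 : Submodule ℝ (GroupLieAlgebra 𝓘(ℝ, E) G)}
    (h𝔪 : IsCompl 𝔪 (subgroupLieAlgebra H)) (u v : 𝔪) : 𝔪 :=
  𝔪.projectionOnto (subgroupLieAlgebra H) h𝔪
    ⁅(u : GroupLieAlgebra 𝓘(ℝ, E) G), (v : GroupLieAlgebra 𝓘(ℝ, E) G)⁆

/-- The connection operator `N(y, v) = ½ Dη(y, v) - ½ [y, v]_𝔪`, where
`Dη(y, v) = d/dt|_{t=0} η(y + t v)`. -/
def connectionOperator (F : TangentBundle (𝓡 n) (G ⧸ H) → ℝ)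
    {𝔪 : Submodule ℝ (GroupLieAlgebra 𝓘(ℝ, E) G)}
    (h𝔪 : IsCompl 𝔪 (subgroupLieAlgebra H)) (y v : 𝔪) : 𝔪 :=
  (1 / 2 : ℝ) • deriv (fun t : ℝ => sprayVectorField F 𝔪 (y + t • v)) 0
    - (1 / 2 : ℝ) • bracketProj h𝔪 y v

end Coset

end

/-! The idea is to describe velocities and parallel fields along a geodesic by their components in a
frame moved by `G`. Since `F` is invariant, the Cartan tensor in these components is constantly the
one at `o`, and only the components have to be differentiated.

Let `f` be the projection `G → G/H` in the charts at `e` and `o`, and let `S` be the inverse of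
`π_*` on `𝔪`. The frame `A(ξ) = df_ξ ∘ leftFrame(ξ) ∘ S` (`cosetFrame`) gives the coordinates of
`g_* v` at `g • o`, where `ξ` are the coordinates of `g`. It is the identity at `e`. Put `B(v, w) =
dA_e(S v) w` (`frameTorsion`). Everything is expressed through `B` and the coordinate objects `G`
and `N` of the spray, evaluated at `o`:

(a) `[v, w]_𝔪 = B(v, w) - B(w, v)`, because the Hessian of `f` is symmetric
(`tangentOriginMap_bracketProj`).

(b) `η(y) = 2 G(y) + B(y, y)`, by differentiating `ẋ = A(ξ) y(t)` and inserting the geodesic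
equation (`tangentOriginMap_of_isSprayVector`).

(c) `N(y, w) = N_coord(w) + B(w, y)`, by differentiating (b) and subtracting half of (a)
(`tangentOriginMap_connectionOperator`).

(d) A parallel field `X = A(ξ) a(t)` with `a(0) = w` has `a'(0) = -(N_coord(w) + B(y, w))`, which by
(a) and (c) is `[w, y]_𝔪 - N(y, w)`. The components of the velocity have derivative `-η(y)`.

The chain rule for `C_{u(t)}(a(t), a(t), a(t))` and the symmetry of the Cartan tensor then give the
formula (`hasDerivAt_cartanTensor`, `cartanTensor_fiberNorm_eq`,
`hasDerivAt_cartanTensor_geodesic`). The curvature and `η` are chosen by `Classical.epsilon`, so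
each also needs an existence proof. This comes from solving one ODE for the geodesic, a parallel
field and the lift to `G` together (`IsLocalFinsler.exists_geodesic`). -/

/-! ### Naturality of the tensors of a Minkowski norm -/

section Naturality

variable {V W : Type*} [AddCommGroup V] [Module ℝ V] [AddCommGroup W] [Module ℝ W]

lemma lineDeriv_comp_linearMap (f : W → ℝ) (T : V →ₗ[ℝ] W) (y v : V) :
    lineDeriv ℝ (fun z => f (T z)) y v = lineDeriv ℝ f (T y) (T v) := by
  simp [lineDeriv, map_add, map_smul]

lemma fundamentalTensor_comp_linearMap (Φ : W → ℝ) (T : V →ₗ[ℝ] W) (y u v : V) :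
    fundamentalTensor (fun z => Φ (T z)) y u v = fundamentalTensor Φ (T y) (T u) (T v) := by
  unfold fundamentalTensor
  simp only [lineDeriv_comp_linearMap (fun z => Φ z ^ 2) T]
  rw [lineDeriv_comp_linearMap (fun y' => lineDeriv ℝ (fun z => Φ z ^ 2) y' (T v)) T]

lemma cartanTensor_comp_linearMap (Φ : W → ℝ) (T : V →ₗ[ℝ] W) (y u v w : V) :
    cartanTensor (fun z => Φ (T z)) y u v w = cartanTensor Φ (T y) (T u) (T v) (T w) := by
  unfold cartanTensor
  simp only [lineDeriv_comp_linearMap (fun z => Φ z ^ 2) T]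
  simp only [lineDeriv_comp_linearMap (fun y' => lineDeriv ℝ (fun z => Φ z ^ 2) y' (T w)) T]
  rw [lineDeriv_comp_linearMap (fun y'' => lineDeriv ℝ (fun y' =>
    lineDeriv ℝ (fun z => Φ z ^ 2) y' (T w)) y'' (T v)) T]

lemma cartanTensor₄_comp_linearMap (Φ : W → ℝ) (T : V →ₗ[ℝ] W) (y u v w z : V) :
    cartanTensor₄ (fun z => Φ (T z)) y u v w z
      = cartanTensor₄ Φ (T y) (T u) (T v) (T w) (T z) := by
  simp [cartanTensor₄, cartanTensor_comp_linearMap]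

end Naturality

/-! ### Directional derivatives of smooth functions -/

section Smooth

variable {V W : Type*} [NormedAddCommGroup V] [NormedSpace ℝ V]
  [NormedAddCommGroup W] [NormedSpace ℝ W]

lemma lineDeriv_slice_fst {Q : V × W → ℝ} {z : V × W} (hQ : DifferentiableAt ℝ Q z) (v : V) :
    lineDeriv ℝ (fun p => Q (p, z.2)) z.1 v = fderiv ℝ Q z (v, 0) := by
  have h1 : HasFDerivAt (fun p : V => (p, z.2)) (ContinuousLinearMap.inl ℝ V W) z.1 :=
    hasFDerivAt_prodMk_left z.1 z.2
  have h2 := (HasFDerivAt.comp (g := Q) z.1 hQ.hasFDerivAt h1).hasLineDerivAt v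
  exact h2.lineDeriv.trans (by simp)

lemma lineDeriv_slice_snd {Q : V × W → ℝ} {z : V × W} (hQ : DifferentiableAt ℝ Q z) (v : W) :
    lineDeriv ℝ (fun p => Q (z.1, p)) z.2 v = fderiv ℝ Q z (0, v) := by
  have h1 : HasFDerivAt (fun p : W => (z.1, p)) (ContinuousLinearMap.inr ℝ V W) z.2 :=
    hasFDerivAt_prodMk_right z.1 z.2
  have h2 := (HasFDerivAt.comp (g := Q) z.2 hQ.hasFDerivAt h1).hasLineDerivAt v
  exact h2.lineDeriv.trans (by simp)

lemma contDiffOn_lineDeriv_fst {Q : V × W → ℝ} {Ω : Set (V × W)} (hΩ : IsOpen Ω)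
    (hQ : ContDiffOn ℝ ∞ Q Ω) (v : V) :
    ContDiffOn ℝ ∞ (fun z => lineDeriv ℝ (fun p => Q (p, z.2)) z.1 v) Ω :=
  ((hQ.fderiv_of_isOpen hΩ (m := ∞) le_rfl).clm_apply contDiffOn_const).congr fun z hz =>
    lineDeriv_slice_fst ((hQ.contDiffAt (hΩ.mem_nhds hz)).differentiableAt (by simp)) v

lemma contDiffOn_lineDeriv_snd {Q : V × W → ℝ} {Ω : Set (V × W)} (hΩ : IsOpen Ω)
    (hQ : ContDiffOn ℝ ∞ Q Ω) (v : W) :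
    ContDiffOn ℝ ∞ (fun z => lineDeriv ℝ (fun p => Q (z.1, p)) z.2 v) Ω :=
  ((hQ.fderiv_of_isOpen hΩ (m := ∞) le_rfl).clm_apply contDiffOn_const).congr fun z hz =>
    lineDeriv_slice_snd ((hQ.contDiffAt (hΩ.mem_nhds hz)).differentiableAt (by simp)) v

lemma lineDeriv_eventuallyEq {q : V → ℝ} {U : Set V} (hU : IsOpen U)
    (hq : ContDiffOn ℝ ∞ q U) {y : V} (hy : y ∈ U) (v : V) :
    (fun y' => lineDeriv ℝ q y' v) =ᶠ[𝓝 y] fun y' => fderiv ℝ q y' v := by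
  filter_upwards [hU.mem_nhds hy] with y' hy'
  exact ((hq.contDiffAt (hU.mem_nhds hy')).differentiableAt (by simp)).lineDeriv_eq_fderiv

lemma lineDeriv_lineDeriv_eq {q : V → ℝ} {U : Set V} (hU : IsOpen U)
    (hq : ContDiffOn ℝ ∞ q U) {y : V} (hy : y ∈ U) (u v : V) :
    lineDeriv ℝ (fun y' => lineDeriv ℝ q y' v) y u = fderiv ℝ (fderiv ℝ q) y u v := by
  rw [(lineDeriv_eventuallyEq hU hq hy v).lineDeriv_eq]
  have h : DifferentiableAt ℝ (fderiv ℝ q) y :=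
    ((hq.fderiv_of_isOpen hU (m := ∞) le_rfl).contDiffAt (hU.mem_nhds hy)).differentiableAt
      (by simp)
  rw [(h.clm_apply (differentiableAt_const v)).lineDeriv_eq_fderiv,
    fderiv_clm_apply h (differentiableAt_const v)]
  simp

/-- Smoothness on an open set, and not only at `y`, allows each inner directional derivative to be
replaced near `y` before the next one is taken. Multilinearity and symmetry of the tensors become
available only through this passage to `fderiv`. -/
lemma lineDeriv_lineDeriv_lineDeriv_eq {q : V → ℝ} {U : Set V} (hU : IsOpen U)
    (hq : ContDiffOn ℝ ∞ q U) {y : V} (hy : y ∈ U) (u v w : V) :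
    lineDeriv ℝ (fun y' => lineDeriv ℝ (fun y'' => lineDeriv ℝ q y'' w) y' v) y u
      = fderiv ℝ (fderiv ℝ (fderiv ℝ q)) y u v w := by
  have e : (fun y' => lineDeriv ℝ (fun y'' => lineDeriv ℝ q y'' w) y' v)
      =ᶠ[𝓝 y] fun y' => fderiv ℝ (fderiv ℝ q) y' v w := by
    filter_upwards [hU.mem_nhds hy] with y' hy' using lineDeriv_lineDeriv_eq hU hq hy' v w
  rw [e.lineDeriv_eq]
  have h : DifferentiableAt ℝ (fderiv ℝ (fderiv ℝ q)) y :=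
    (((hq.fderiv_of_isOpen hU (m := ∞) le_rfl).fderiv_of_isOpen hU (m := ∞) le_rfl).contDiffAt
      (hU.mem_nhds hy)).differentiableAt (by simp)
  have h1 := h.clm_apply (differentiableAt_const v)
  rw [(h1.clm_apply (differentiableAt_const w)).lineDeriv_eq_fderiv,
    fderiv_clm_apply h1 (differentiableAt_const w), fderiv_clm_apply h (differentiableAt_const v)]
  simp

lemma fundamentalTensor_eq_fderiv {Φ : V → ℝ} {U : Set V} (hU : IsOpen U)
    (hq : ContDiffOn ℝ ∞ (fun z => Φ z ^ 2) U) {y : V} (hy : y ∈ U) (u v : V) :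
    fundamentalTensor Φ y u v = (1 / 2) * fderiv ℝ (fderiv ℝ fun z => Φ z ^ 2) y u v := by
  rw [fundamentalTensor, lineDeriv_lineDeriv_eq hU hq hy]

lemma cartanTensor_eq_fderiv {Φ : V → ℝ} {U : Set V} (hU : IsOpen U)
    (hq : ContDiffOn ℝ ∞ (fun z => Φ z ^ 2) U) {y : V} (hy : y ∈ U) (u v w : V) :
    cartanTensor Φ y u v w
      = (1 / 4) * fderiv ℝ (fderiv ℝ (fderiv ℝ fun z => Φ z ^ 2)) y u v w := by
  rw [cartanTensor, lineDeriv_lineDeriv_lineDeriv_eq hU hq hy]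

lemma fderiv_fderiv_symm {X : Type*} [NormedAddCommGroup X] [NormedSpace ℝ X] {q : V → X}
    {U : Set V} (hU : IsOpen U) (hq : ContDiffOn ℝ ∞ q U) {y : V} (hy : y ∈ U) (u v : V) :
    fderiv ℝ (fderiv ℝ q) y u v = fderiv ℝ (fderiv ℝ q) y v u :=
  ((hq.contDiffAt (hU.mem_nhds hy)).isSymmSndFDerivAt
    (by
      simp only [minSmoothness_of_isRCLikeNormedField]
      exact WithTop.coe_le_coe.2 (le_top : (2 : ℕ∞) ≤ ⊤))) u v

/-- Differentiating the symmetry of the second derivative in the direction `u`. Together with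
`fderiv_fderiv_symm` applied to `fderiv ℝ q`, it gives full symmetry of the third derivative. -/
lemma fderiv₃_symm_right {q : V → ℝ}
    {U : Set V} (hU : IsOpen U) (hq : ContDiffOn ℝ ∞ q U) {y : V} (hy : y ∈ U) (u v w : V) :
    fderiv ℝ (fderiv ℝ (fderiv ℝ q)) y u v w = fderiv ℝ (fderiv ℝ (fderiv ℝ q)) y u w v := by
  have h : DifferentiableAt ℝ (fderiv ℝ (fderiv ℝ q)) y :=
    (((hq.fderiv_of_isOpen hU (m := ∞) le_rfl).fderiv_of_isOpen hU (m := ∞) le_rfl).contDiffAt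
      (hU.mem_nhds hy)).differentiableAt (by simp)
  have h1 : ∀ a b : V, fderiv ℝ (fun y' => fderiv ℝ (fderiv ℝ q) y' a b) y u
      = fderiv ℝ (fderiv ℝ (fderiv ℝ q)) y u a b := by
    intro a b
    have h2 := h.clm_apply (differentiableAt_const a)
    rw [fderiv_clm_apply h2 (differentiableAt_const b),
      fderiv_clm_apply h (differentiableAt_const a)]
    simp
  rw [← h1, ← h1]
  have e : (fun y' => fderiv ℝ (fderiv ℝ q) y' v w) =ᶠ[𝓝 y]
      fun y' => fderiv ℝ (fderiv ℝ q) y' w v := by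
    filter_upwards [hU.mem_nhds hy] with y' hy' using fderiv_fderiv_symm hU hq hy' v w
  rw [e.fderiv_eq]

set_option maxSynthPendingDepth 5 in
lemma hasDerivAt_trilinear {T : V → V →L[ℝ] V →L[ℝ] V →L[ℝ] ℝ}
    {T' : V →L[ℝ] V →L[ℝ] V →L[ℝ] V →L[ℝ] ℝ} {u a b c : ℝ → V} {u' a' b' c' : V}
    (hT : HasFDerivAt T T' (u 0)) (hu : HasDerivAt u u' 0) (ha : HasDerivAt a a' 0)
    (hb : HasDerivAt b b' 0) (hc : HasDerivAt c c' 0) :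
    HasDerivAt (fun t => T (u t) (a t) (b t) (c t))
      (T' u' (a 0) (b 0) (c 0) + T (u 0) a' (b 0) (c 0) + T (u 0) (a 0) b' (c 0)
        + T (u 0) (a 0) (b 0) c') 0 := by
  have h1 : HasDerivAt (fun t => T (u t)) (T' u') 0 := HasFDerivAt.comp_hasDerivAt 0 hT hu
  have h2 := ((h1.clm_apply ha).clm_apply hb).clm_apply hc
  refine h2.congr_deriv ?_
  simp only [add_apply]

lemma hasFDerivAt_fderiv₃ {q : V → ℝ} {U : Set V} (hU : IsOpen U) (hq : ContDiffOn ℝ ∞ q U)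
    {y : V} (hy : y ∈ U) : HasFDerivAt (fderiv ℝ (fderiv ℝ (fderiv ℝ q)))
      (fderiv ℝ (fderiv ℝ (fderiv ℝ (fderiv ℝ q))) y) y :=
  ((((hq.fderiv_of_isOpen hU (m := ∞) le_rfl).fderiv_of_isOpen hU (m := ∞) le_rfl
      ).fderiv_of_isOpen hU (m := ∞) le_rfl).contDiffAt (hU.mem_nhds hy)).differentiableAt
      (by simp) |>.hasFDerivAt

lemma cartanTensor₄_eq_fderiv {Φ : V → ℝ} {U : Set V} (hU : IsOpen U)
    (hq : ContDiffOn ℝ ∞ (fun z => Φ z ^ 2) U) {y : V} (hy : y ∈ U) (w₁ w₂ w₃ w₄ : V) :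
    cartanTensor₄ Φ y w₁ w₂ w₃ w₄
      = (1 / 4) * fderiv ℝ (fderiv ℝ (fderiv ℝ (fderiv ℝ fun z => Φ z ^ 2))) y w₄ w₁ w₂ w₃ := by
  have hl : HasDerivAt (fun t : ℝ => y + t • w₄) w₄ 0 := by
    simpa using ((hasDerivAt_id (0 : ℝ)).smul_const w₄).const_add y
  have e : (fun t : ℝ => cartanTensor Φ (y + t • w₄) w₁ w₂ w₃) =ᶠ[𝓝 0] fun t : ℝ =>
      (1 / 4) * fderiv ℝ (fderiv ℝ (fderiv ℝ fun z => Φ z ^ 2)) (y + t • w₄) w₁ w₂ w₃ := by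
    have : ∀ᶠ t : ℝ in 𝓝 0, y + t • w₄ ∈ U :=
      hl.continuousAt.eventually_mem (hU.mem_nhds (by simpa using hy))
    filter_upwards [this] with t ht using cartanTensor_eq_fderiv hU hq ht w₁ w₂ w₃
  have h := hasDerivAt_trilinear (u := fun t : ℝ => y + t • w₄)
    (by simpa only [zero_smul, add_zero] using hasFDerivAt_fderiv₃ hU hq hy) hl
    (hasDerivAt_const (0 : ℝ) w₁) (hasDerivAt_const (0 : ℝ) w₂) (hasDerivAt_const (0 : ℝ) w₃)
  rw [cartanTensor₄, e.deriv_eq, (h.const_mul (1 / 4 : ℝ)).deriv]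
  simp only [map_zero, zero_apply, add_zero]

/-- The derivative of the Cartan tensor along curves, at a point where its three arguments, and
also their derivatives, coincide. -/
lemma hasDerivAt_cartanTensor {Φ : V → ℝ} {U : Set V} (hU : IsOpen U)
    (hq : ContDiffOn ℝ ∞ (fun z => Φ z ^ 2) U) {y y' w w' : V} (hy : y ∈ U)
    {u a b c : ℝ → V} (hu : HasDerivAt u y' 0) (hu0 : u 0 = y)
    (ha : HasDerivAt a w' 0) (ha0 : a 0 = w) (hb : HasDerivAt b w' 0) (hb0 : b 0 = w)
    (hc : HasDerivAt c w' 0) (hc0 : c 0 = w) :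
    HasDerivAt (fun t => cartanTensor Φ (u t) (a t) (b t) (c t))
      (3 * cartanTensor Φ y w w w' + cartanTensor₄ Φ y w w w y') 0 := by
  have e : (fun t => cartanTensor Φ (u t) (a t) (b t) (c t)) =ᶠ[𝓝 0] fun t : ℝ =>
      (1 / 4) * fderiv ℝ (fderiv ℝ (fderiv ℝ fun z => Φ z ^ 2)) (u t) (a t) (b t) (c t) := by
    have : ∀ᶠ t : ℝ in 𝓝 0, u t ∈ U :=
      hu.continuousAt.eventually_mem (hU.mem_nhds (by simpa [hu0] using hy))
    filter_upwards [this] with t ht using cartanTensor_eq_fderiv hU hq ht _ _ _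
  have h1 := ((hasDerivAt_trilinear (by rw [hu0]; exact hasFDerivAt_fderiv₃ hU hq hy)
    hu ha hb hc).const_mul (1 / 4 : ℝ)).congr_of_eventuallyEq e
  refine h1.congr_deriv ?_
  -- The product rule yields `w'` once in each slot. Symmetry moves it to the last one, whence the
  -- factor 3.
  have s1 : fderiv ℝ (fderiv ℝ (fderiv ℝ fun z => Φ z ^ 2)) y w w' w
      = fderiv ℝ (fderiv ℝ (fderiv ℝ fun z => Φ z ^ 2)) y w w w' :=
    fderiv₃_symm_right hU hq hy w w' w
  have s2 : fderiv ℝ (fderiv ℝ (fderiv ℝ fun z => Φ z ^ 2)) y w' w w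
      = fderiv ℝ (fderiv ℝ (fderiv ℝ fun z => Φ z ^ 2)) y w w' w := by
    rw [fderiv_fderiv_symm hU (hq.fderiv_of_isOpen hU (m := ∞) le_rfl) hy]
  simp only [cartanTensor_eq_fderiv hU hq hy, cartanTensor₄_eq_fderiv hU hq hy,
    hu0, ha0, hb0, hc0, s1, s2]
  ring

lemma cartanTensor₄_neg {Φ : V → ℝ} {U : Set V} (hU : IsOpen U)
    (hq : ContDiffOn ℝ ∞ (fun z => Φ z ^ 2) U) {y : V} (hy : y ∈ U) (w₁ w₂ w₃ w₄ : V) :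
    cartanTensor₄ Φ y w₁ w₂ w₃ (-w₄) = -cartanTensor₄ Φ y w₁ w₂ w₃ w₄ := by
  simp [cartanTensor₄_eq_fderiv hU hq hy]

/-- Smooth vector fields have smooth integral curves. -/
lemma exists_smooth_integralCurve {Z : Type*} [NormedAddCommGroup Z] [NormedSpace ℝ Z]
    [CompleteSpace Z] {X : Z → Z} {Ω : Set Z} (hΩ : IsOpen Ω) (hX : ContDiffOn ℝ ∞ X Ω)
    {z₀ : Z} (hz₀ : z₀ ∈ Ω) :
    ∃ γ : ℝ → Z, γ 0 = z₀ ∧ ∀ᶠ t in 𝓝 0, γ t ∈ Ω ∧ HasDerivAt γ (X (γ t)) t ∧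
      ContDiffAt ℝ ∞ γ t := by
  obtain ⟨γ, h0, ε, hε, hγ⟩ := ((hX.contDiffAt (hΩ.mem_nhds hz₀)).of_le (m := 1)
    (by simp)).exists_forall_mem_closedBall_exists_eq_forall_mem_Ioo_hasDerivAt₀ 0
  have hd : ∀ᶠ t in 𝓝 (0 : ℝ), HasDerivAt γ (X (γ t)) t := by
    filter_upwards [Ioo_mem_nhds (show (0 : ℝ) - ε < 0 by linarith)
      (show (0 : ℝ) < 0 + ε by linarith)] with t ht using hγ t ht
  have hm : ∀ᶠ t in 𝓝 (0 : ℝ), γ t ∈ Ω :=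
    hd.self_of_nhds.continuousAt.eventually_mem (hΩ.mem_nhds (by rwa [h0]))
  obtain ⟨δ, hδ, hb⟩ := Metric.eventually_nhds_iff_ball.1 (hd.and hm)
  have hsub : ∀ t ∈ Set.Icc (-(δ / 2)) (δ / 2), t ∈ Metric.ball (0 : ℝ) δ := by
    intro t ht
    rw [Metric.mem_ball, Real.dist_eq, sub_zero, abs_lt]
    constructor <;> linarith [ht.1, ht.2]
  -- Picard–Lindelöf gives an integral curve, and smoothness of the field bootstraps its regularity.
  -- The regularity theorem concerns closed intervals, so the radius is halved.
  have hs : ContDiffOn ℝ ∞ γ (Set.Icc (-(δ / 2)) (δ / 2)) := by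
    refine ODE.contDiffOn_enat_Icc_of_hasDerivWithinAt (n := ⊤) (f := fun _ => X) (u := Ω) ?_ ?_ ?_
    · exact hX.comp contDiffOn_snd fun z hz => hz.2
    · exact fun t ht => (hb t (hsub t ht)).1.hasDerivWithinAt
    · exact fun t ht => (hb t (hsub t ht)).2
  refine ⟨γ, h0, ?_⟩
  filter_upwards [hd, hm, Ioo_mem_nhds (show -(δ / 2) < 0 by linarith)
    (show (0 : ℝ) < δ / 2 by linarith)] with t h1 h2 h3
  exact ⟨h2, h1, hs.contDiffAt (Icc_mem_nhds h3.1 h3.2)⟩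

end Smooth

/-! ### Smoothness of the spray coefficients -/

section Spray

variable {n : ℕ} {L : EuclideanSpace ℝ (Fin n) → EuclideanSpace ℝ (Fin n) → ℝ}
  {Ω : Set (EuclideanSpace ℝ (Fin n) × EuclideanSpace ℝ (Fin n))}

/-- Cramer's rule: the entries of the inverse are quotients of determinants, hence rational
functions of the entries. -/
lemma contDiffOn_matrix_inv {X ι : Type*} [NormedAddCommGroup X] [NormedSpace ℝ X] [Fintype ι]
    [DecidableEq ι] {A : X → Matrix ι ι ℝ} {s : Set X}
    (hA : ∀ i j, ContDiffOn ℝ ∞ (fun x => A x i j) s) (hdet : ∀ x ∈ s, (A x).det ≠ 0) (i j : ι) :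
    ContDiffOn ℝ ∞ (fun x => (A x)⁻¹ i j) s := by
  have hd : ∀ B : X → Matrix ι ι ℝ, (∀ i j, ContDiffOn ℝ ∞ (fun x => B x i j) s) →
      ContDiffOn ℝ ∞ (fun x => (B x).det) s := by
    intro B hB
    simp only [Matrix.det_apply]
    exact ContDiffOn.sum fun σ _ => (contDiffOn_prod fun k _ => hB _ _).const_smul _
  have h : ∀ x, (A x)⁻¹ i j = ((A x).det)⁻¹ * ((A x).updateRow j (Pi.single i 1)).det := by
    intro x
    rw [Matrix.inv_def, Matrix.smul_apply, Matrix.adjugate_apply, Ring.inverse_eq_inv', smul_eq_mul]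
  simp only [h]
  refine ((hd A hA).inv hdet).mul (hd _ fun k l => ?_)
  by_cases hk : k = j
  · subst hk
    simpa using contDiffOn_const
  · simpa [Matrix.updateRow_ne hk] using hA k l

lemma isOpen_slice (hΩ : IsOpen Ω) (p : EuclideanSpace ℝ (Fin n)) :
    IsOpen {v | (p, v) ∈ Ω} :=
  hΩ.preimage (by fun_prop : Continuous fun v : EuclideanSpace ℝ (Fin n) => (p, v))

lemma contDiffOn_slice (hL : ContDiffOn ℝ ∞ (fun z => L z.1 z.2 ^ 2) Ω)
    (p : EuclideanSpace ℝ (Fin n)) : ContDiffOn ℝ ∞ (fun v => L p v ^ 2) {v | (p, v) ∈ Ω} :=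
  hL.comp (contDiff_prodMk_right p).contDiffOn fun _ hv => hv

/-- A kernel vector `a` of the matrix would give a nonzero `u = ∑ aᵢ eᵢ` with `g(u, u) = 0`, against
strong convexity. Bilinearity of `g` is read from its expression by the second Fréchet derivative.
-/
lemma fundamentalMatrix_det_ne_zero (hΩ : IsOpen Ω)
    (hL : ContDiffOn ℝ ∞ (fun z => L z.1 z.2 ^ 2) Ω)
    (hpos : ∀ z ∈ Ω, ∀ u, u ≠ 0 → 0 < fundamentalTensor (L z.1) z.2 u u)
    {z : EuclideanSpace ℝ (Fin n) × EuclideanSpace ℝ (Fin n)} (hz : z ∈ Ω) :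
    (fundamentalMatrix L z.1 z.2).det ≠ 0 := by
  intro h0
  obtain ⟨a, ha, hMa⟩ := Matrix.exists_mulVec_eq_zero_iff.2 h0
  have hsum : (∑ i, a i • coordVec i : EuclideanSpace ℝ (Fin n)) = WithLp.toLp 2 a := by
    ext k
    simp [Pi.single_apply]
  have hne : (∑ i, a i • coordVec i : EuclideanSpace ℝ (Fin n)) ≠ 0 := by
    rw [hsum]
    intro h
    exact ha (by simpa using congrArg WithLp.ofLp h)
  have hp := hpos z hz _ hne
  have hf : ∀ u v, fundamentalTensor (L z.1) z.2 u v
      = (1 / 2) * fderiv ℝ (fderiv ℝ fun v => L z.1 v ^ 2) z.2 u v := fun u v =>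
    fundamentalTensor_eq_fderiv (isOpen_slice hΩ z.1) (contDiffOn_slice hL z.1) (y := z.2) hz u v
  have hq : ∑ i, a i * (Matrix.mulVec (fundamentalMatrix L z.1 z.2) a) i = 0 := by
    simp [hMa]
  simp only [Matrix.mulVec, dotProduct, fundamentalMatrix, Matrix.of_apply, hf] at hq
  rw [hf] at hp
  simp only [map_sum, map_smul, sum_apply, smul_apply,
    smul_eq_mul] at hp
  refine hp.ne' (Eq.trans ?_ hq)
  simp only [Finset.mul_sum]
  rw [Finset.sum_comm]
  refine Finset.sum_congr rfl fun i _ => ?_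
  refine Finset.sum_congr rfl fun j _ => ?_
  ring

lemma contDiffOn_sprayCoeff (hΩ : IsOpen Ω)
    (hL : ContDiffOn ℝ ∞ (fun z => L z.1 z.2 ^ 2) Ω)
    (hpos : ∀ z ∈ Ω, ∀ u, u ≠ 0 → 0 < fundamentalTensor (L z.1) z.2 u u) (i : Fin n) :
    ContDiffOn ℝ ∞ (fun z => sprayCoeff L z.1 z.2 i) Ω := by
  have hv : ∀ l, ContDiffOn ℝ ∞ (fun z => lineDeriv ℝ (fun v' => L z.1 v' ^ 2) z.2 (coordVec l)) Ω :=
    fun l => contDiffOn_lineDeriv_snd hΩ hL _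
  unfold sprayCoeff
  refine contDiffOn_const.mul (ContDiffOn.sum fun l _ => ContDiffOn.mul ?_ (ContDiffOn.sub
    (ContDiffOn.sum fun k _ => ContDiffOn.mul ?_ ?_) ?_))
  · refine contDiffOn_matrix_inv (fun i j => ?_)
      (fun z hz => fundamentalMatrix_det_ne_zero hΩ hL hpos hz) i l
    simp only [fundamentalMatrix, Matrix.of_apply, fundamentalTensor]
    exact contDiffOn_const.mul (contDiffOn_lineDeriv_snd hΩ (hv j) _)
  · exact contDiffOn_lineDeriv_fst hΩ (hv l) _
  · fun_prop
  · exact contDiffOn_lineDeriv_fst hΩ hL _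

lemma contDiffOn_connectionCoeff (hΩ : IsOpen Ω)
    (hL : ContDiffOn ℝ ∞ (fun z => L z.1 z.2 ^ 2) Ω)
    (hpos : ∀ z ∈ Ω, ∀ u, u ≠ 0 → 0 < fundamentalTensor (L z.1) z.2 u u) (i j : Fin n) :
    ContDiffOn ℝ ∞ (fun z => connectionCoeff L z.1 z.2 i j) Ω :=
  contDiffOn_lineDeriv_snd hΩ (contDiffOn_sprayCoeff hΩ hL hpos i) _

end Spray

/-! ### Moving frames -/

section Frame

variable {E V : Type*} [NormedAddCommGroup E] [NormedSpace ℝ E]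
  [NormedAddCommGroup V] [NormedSpace ℝ V]

lemma isOpen_isInvertible [CompleteSpace V] : IsOpen {T : V →L[ℝ] V | T.IsInvertible} := by
  have : {T : V →L[ℝ] V | T.IsInvertible}
      = Set.range ((↑) : (V ≃L[ℝ] V) → V →L[ℝ] V) := by
    ext T
    simp [ContinuousLinearMap.IsInvertible]
  rw [this]
  exact ContinuousLinearEquiv.isOpen

lemma ContinuousLinearMap.IsInvertible.apply_inverse_apply {T : V →L[ℝ] V} (hT : T.IsInvertible)
    (v : V) : T (T.inverse v) = v := by
  obtain ⟨e, rfl⟩ := hT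
  simp

lemma hasDerivAt_frame_apply {A : E → V →L[ℝ] V} {e₀ : E} (hA : DifferentiableAt ℝ A e₀)
    (hA₀ : A e₀ = ContinuousLinearMap.id ℝ V) {ξ : ℝ → E} {ξ' : E} (hξ : HasDerivAt ξ ξ' 0)
    (hξ₀ : ξ 0 = e₀) {a : ℝ → V} {a' : V} (ha : HasDerivAt a a' 0) :
    HasDerivAt (fun t => A (ξ t) (a t)) (fderiv ℝ A e₀ ξ' (a 0) + a') 0 := by
  subst hξ₀
  have h1 : HasDerivAt (fun t => A (ξ t)) (fderiv ℝ A (ξ 0) ξ') 0 :=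
    HasFDerivAt.comp_hasDerivAt 0 hA.hasFDerivAt hξ
  simpa [hA₀] using h1.clm_apply ha

/-- The components of a curve of vectors with respect to a moving frame which is standard at the
initial point. -/
lemma hasDerivAt_frame_inverse [CompleteSpace V] {A : E → V →L[ℝ] V} {e₀ : E}
    (hA : DifferentiableAt ℝ A e₀)
    (hA₀ : A e₀ = ContinuousLinearMap.id ℝ V) {ξ : ℝ → E} {ξ' : E} (hξ : HasDerivAt ξ ξ' 0)
    (hξ₀ : ξ 0 = e₀) {X : ℝ → V} {X' : V} (hX : HasDerivAt X X' 0) :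
    HasDerivAt (fun t => (A (ξ t)).inverse (X t)) (X' - fderiv ℝ A e₀ ξ' (X 0)) 0 := by
  have hinv : (A e₀).IsInvertible := by
    rw [hA₀]; exact ⟨ContinuousLinearEquiv.refl ℝ V, rfl⟩
  have h1 : DifferentiableAt ℝ (fun T : V →L[ℝ] V => T.inverse) (A (ξ 0)) := by
    rw [hξ₀]
    exact (hinv.contDiffAt_map_inverse (n := 1)).differentiableAt one_ne_zero
  have h2 : DifferentiableAt ℝ (fun t => A (ξ t)) 0 := by
    refine DifferentiableAt.comp (g := A) 0 ?_ hξ.differentiableAt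
    rwa [hξ₀]
  have h3 : DifferentiableAt ℝ (fun t => (A (ξ t)).inverse) 0 :=
    DifferentiableAt.comp (g := fun T : V →L[ℝ] V => T.inverse) 0 h1 h2
  have h4 := (h3.hasDerivAt.clm_apply hX)
  -- Only differentiability of the inverse is used. Its derivative is found by applying the product
  -- rule to `A (A⁻¹ X) = X` and solving, as `A` is the identity at the initial point.
  have h5 := hasDerivAt_frame_apply hA hA₀ hξ hξ₀ h4
  have e : (fun t => A (ξ t) ((A (ξ t)).inverse (X t))) =ᶠ[𝓝 0] X := by
    have : ∀ᶠ t in 𝓝 0, (A (ξ t)).IsInvertible :=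
      h2.continuousAt.eventually_mem (isOpen_isInvertible.mem_nhds
        (show (A (ξ 0)).IsInvertible by rwa [hξ₀]))
    filter_upwards [this] with t ht using ht.apply_inverse_apply _
  have h6 := (h5.congr_of_eventuallyEq e.symm).unique hX
  refine h4.congr_deriv ?_
  rw [hξ₀, hA₀, ContinuousLinearMap.inverse_id] at h6 ⊢
  rw [eq_sub_iff_add_eq, add_comm]
  exact h6

end Frame

/-! ### The geodesic equation in coordinates -/

section Geodesic

variable {n : ℕ}

/-- The vector with components `G^i`. -/
noncomputable def sprayVec
    (L : EuclideanSpace ℝ (Fin n) → EuclideanSpace ℝ (Fin n) → ℝ)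
    (p v : EuclideanSpace ℝ (Fin n)) : EuclideanSpace ℝ (Fin n) :=
  WithLp.toLp 2 fun i => sprayCoeff L p v i

/-- The vector with components `N^i_j w^j`. -/
noncomputable def connectionVec
    (L : EuclideanSpace ℝ (Fin n) → EuclideanSpace ℝ (Fin n) → ℝ)
    (p v w : EuclideanSpace ℝ (Fin n)) : EuclideanSpace ℝ (Fin n) :=
  WithLp.toLp 2 fun i => ∑ j, connectionCoeff L p v i j * w j

variable {L : EuclideanSpace ℝ (Fin n) → EuclideanSpace ℝ (Fin n) → ℝ}
  {B : Set (EuclideanSpace ℝ (Fin n))}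

/-- The function `L` is the expression of a Finsler metric in local coordinates, over the open
set `B`. -/
structure IsLocalFinsler (L : EuclideanSpace ℝ (Fin n) → EuclideanSpace ℝ (Fin n) → ℝ)
    (B : Set (EuclideanSpace ℝ (Fin n))) : Prop where
  isOpen : IsOpen B
  smooth : ContDiffOn ℝ ∞ (fun z : EuclideanSpace ℝ (Fin n) × EuclideanSpace ℝ (Fin n) =>
    L z.1 z.2 ^ 2) (B ×ˢ {0}ᶜ)
  pos : ∀ p ∈ B, ∀ v, v ≠ 0 → ∀ u, u ≠ 0 → 0 < fundamentalTensor (L p) v u u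

namespace IsLocalFinsler

lemma isOpen_prod (hL : IsLocalFinsler L B) :
    IsOpen (B ×ˢ ({0}ᶜ : Set (EuclideanSpace ℝ (Fin n)))) :=
  hL.isOpen.prod isOpen_compl_singleton

lemma contDiffOn_fiber (hL : IsLocalFinsler L B) {p : EuclideanSpace ℝ (Fin n)} (hp : p ∈ B) :
    ContDiffOn ℝ ∞ (fun v => L p v ^ 2) {0}ᶜ :=
  hL.smooth.comp (contDiff_prodMk_right p).contDiffOn fun _ hv => ⟨hp, hv⟩

lemma contDiffOn_sprayCoeff (hL : IsLocalFinsler L B) (i : Fin n) :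
    ContDiffOn ℝ ∞ (fun z : EuclideanSpace ℝ (Fin n) × EuclideanSpace ℝ (Fin n) =>
      sprayCoeff L z.1 z.2 i) (B ×ˢ {0}ᶜ) :=
  _root_.contDiffOn_sprayCoeff hL.isOpen_prod hL.smooth (fun z hz => hL.pos z.1 hz.1 z.2 hz.2) i

lemma contDiffOn_sprayVec (hL : IsLocalFinsler L B) :
    ContDiffOn ℝ ∞ (fun z : EuclideanSpace ℝ (Fin n) × EuclideanSpace ℝ (Fin n) =>
      sprayVec L z.1 z.2) (B ×ˢ {0}ᶜ) :=
  contDiffOn_euclidean.2 hL.contDiffOn_sprayCoeff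

lemma contDiffOn_connectionVec (hL : IsLocalFinsler L B) :
    ContDiffOn ℝ ∞ (fun z : (EuclideanSpace ℝ (Fin n) × EuclideanSpace ℝ (Fin n)) ×
      EuclideanSpace ℝ (Fin n) => connectionVec L z.1.1 z.1.2 z.2)
      ((B ×ˢ {0}ᶜ) ×ˢ Set.univ) := by
  refine contDiffOn_euclidean.2 fun i => ?_
  simp only [connectionVec]
  refine ContDiffOn.sum fun j _ => ContDiffOn.mul ?_ ?_
  · exact (_root_.contDiffOn_connectionCoeff hL.isOpen_prod hL.smooth
      (fun z hz => hL.pos z.1 hz.1 z.2 hz.2) i j).comp contDiffOn_fst fun z hz => hz.1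
  · fun_prop

/-- Off the zero section the spray coefficients are Fréchet differentiable, so the partial
derivatives `N^i_j` assemble linearly into any directional derivative. This is the link between
`N^i_j` and the derivative of `η` in the connection operator. -/
lemma hasDerivAt_sprayVec (hL : IsLocalFinsler L B) {p y : EuclideanSpace ℝ (Fin n)}
    (hp : p ∈ B) (hy : y ≠ 0) (w : EuclideanSpace ℝ (Fin n)) :
    HasDerivAt (fun t : ℝ => sprayVec L p (y + t • w)) (connectionVec L p y w) 0 := by
  suffices h : HasDerivAt (fun (t : ℝ) (i : Fin n) => sprayCoeff L p (y + t • w) i)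
      (fun i => ∑ j, connectionCoeff L p y i j * w j) 0 from
    HasFDerivAt.comp_hasDerivAt 0
      (PiLp.continuousLinearEquiv 2 ℝ fun _ : Fin n => ℝ).symm.hasFDerivAt h
  rw [hasDerivAt_pi]
  intro i
  have hd : DifferentiableAt ℝ (fun v => sprayCoeff L p v i) y := by
    have h1 : ContDiffOn ℝ ∞ (fun v => sprayCoeff L p v i) {0}ᶜ :=
      (hL.contDiffOn_sprayCoeff i).comp (f := fun v => (p, v))
        (contDiff_prodMk_right p).contDiffOn fun _ hv => ⟨hp, hv⟩
    exact (h1.contDiffAt (isOpen_compl_singleton.mem_nhds hy)).differentiableAt (by simp)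
  have h2 := hd.hasFDerivAt.hasLineDerivAt w
  unfold HasLineDerivAt at h2
  refine h2.congr_deriv ?_
  clear h2
  have hw : w = ∑ j, w j • coordVec j := by
    ext k
    simp [Pi.single_apply]
  simp only [connectionCoeff, hd.lineDeriv_eq_fderiv]
  conv_lhs => rw [hw]
  simp [map_sum, mul_comm]

end IsLocalFinsler

variable {E : Type*} [NormedAddCommGroup E] [NormedSpace ℝ E]

/-- Existence of geodesics, together with a parallel field and a horizontal lift for a
submersion `f`, whose horizontal spaces are spanned by the frame `Ψ`. -/
lemma IsLocalFinsler.exists_geodesic [CompleteSpace E] (hL : IsLocalFinsler L B)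
    {f : E → EuclideanSpace ℝ (Fin n)} {Ψ : E → EuclideanSpace ℝ (Fin n) →L[ℝ] E} {U : Set E}
    (hU : IsOpen U) (hf : ContDiffOn ℝ ∞ f U) (hΨ : ContDiffOn ℝ ∞ Ψ U) {e₀ : E} (he₀ : e₀ ∈ U)
    (hx₀ : f e₀ ∈ B)
    (hA₀ : fderiv ℝ f e₀ ∘L Ψ e₀ = ContinuousLinearMap.id ℝ (EuclideanSpace ℝ (Fin n)))
    {y : EuclideanSpace ℝ (Fin n)} (hy : y ≠ 0) (w : EuclideanSpace ℝ (Fin n)) :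
    ∃ (x X : ℝ → EuclideanSpace ℝ (Fin n)) (ξ : ℝ → E),
      x 0 = f e₀ ∧ deriv x 0 = y ∧ X 0 = w ∧ ξ 0 = e₀ ∧
      ∀ᶠ t in 𝓝 0, x t ∈ B ∧ ξ t ∈ U ∧ ContDiffAt ℝ ∞ x t ∧ ContDiffAt ℝ ∞ X t ∧
        ContDiffAt ℝ ∞ ξ t ∧ deriv x t ≠ 0 ∧
        deriv (deriv x) t + (2 : ℝ) • sprayVec L (x t) (deriv x t) = 0 ∧
        deriv X t + connectionVec L (x t) (deriv x t) (X t) = 0 ∧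
        f (ξ t) = x t ∧
        HasDerivAt ξ (Ψ (ξ t) ((fderiv ℝ f (ξ t) ∘L Ψ (ξ t)).inverse (deriv x t))) t := by
  set A : E → (EuclideanSpace ℝ (Fin n)) →L[ℝ] (EuclideanSpace ℝ (Fin n)) := fun ξ => fderiv ℝ f ξ ∘L Ψ ξ with hA
  have hAs : ContDiffOn ℝ ∞ A U := (hf.fderiv_of_isOpen hU (m := ∞) le_rfl).clm_comp hΨ
  -- The lift equation inverts `A`, so the domain is cut down to the open set where this is
  -- possible; it contains `e₀`.
  set U' : Set E := U ∩ A ⁻¹' {T | T.IsInvertible} with hU'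
  have hU'o : IsOpen U' := hAs.continuousOn.isOpen_inter_preimage hU isOpen_isInvertible
  have hinv : ContDiffOn ℝ ∞ (fun ξ => (A ξ).inverse) U' := by
    intro ξ hξ
    have h1 : ContDiffAt ℝ ∞ (fun T : (EuclideanSpace ℝ (Fin n)) →L[ℝ] (EuclideanSpace ℝ (Fin n)) => T.inverse) (A ξ) :=
      ContinuousLinearMap.IsInvertible.contDiffAt_map_inverse hξ.2
    exact (h1.comp ξ (hAs.contDiffAt (hU.mem_nhds hξ.1))).contDiffWithinAt
  set Ω : Set (EuclideanSpace ℝ (Fin n) × EuclideanSpace ℝ (Fin n) ×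
      EuclideanSpace ℝ (Fin n) × E) := {z | (z.1, z.2.1) ∈ B ×ˢ ({0}ᶜ : Set (EuclideanSpace ℝ (Fin n))) ∧ z.2.2.2 ∈ U'} with hΩ
  have hΩo : IsOpen Ω :=
    (hL.isOpen_prod.preimage (by fun_prop :
      Continuous fun z : EuclideanSpace ℝ (Fin n) × EuclideanSpace ℝ (Fin n) ×
      EuclideanSpace ℝ (Fin n) × E => (z.1, z.2.1))).inter
      (hU'o.preimage (by fun_prop : Continuous fun z : EuclideanSpace ℝ (Fin n) × EuclideanSpace ℝ (Fin n) ×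
      EuclideanSpace ℝ (Fin n) × E => z.2.2.2))
  -- One first-order system for position, velocity, parallel field and lift. In the last entry `A⁻¹
  -- ẋ` are the components of the velocity, and `Ψ` turns them into a horizontal velocity above.
  set Y : EuclideanSpace ℝ (Fin n) × EuclideanSpace ℝ (Fin n) ×
      EuclideanSpace ℝ (Fin n) × E → EuclideanSpace ℝ (Fin n) × EuclideanSpace ℝ (Fin n) ×
      EuclideanSpace ℝ (Fin n) × E := fun z =>
    (z.2.1, -((2 : ℝ) • sprayVec L z.1 z.2.1), -connectionVec L z.1 z.2.1 z.2.2.1,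
      Ψ z.2.2.2 ((A z.2.2.2).inverse z.2.1)) with hY
  have hYs : ContDiffOn ℝ ∞ Y Ω := by
    refine ContDiffOn.prodMk (by fun_prop) (ContDiffOn.prodMk ?_ (ContDiffOn.prodMk ?_ ?_))
    · refine (ContDiffOn.const_smul (2 : ℝ) ?_).neg
      exact hL.contDiffOn_sprayVec.comp (f := fun z : EuclideanSpace ℝ (Fin n) × EuclideanSpace ℝ (Fin n) ×
      EuclideanSpace ℝ (Fin n) × E => (z.1, z.2.1))
        (by fun_prop) fun z hz => hz.1
    · refine ContDiffOn.neg ?_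
      exact hL.contDiffOn_connectionVec.comp
        (f := fun z : EuclideanSpace ℝ (Fin n) × EuclideanSpace ℝ (Fin n) ×
      EuclideanSpace ℝ (Fin n) × E => ((z.1, z.2.1), z.2.2.1))
        (by fun_prop) fun z hz => ⟨hz.1, trivial⟩
    · refine ContDiffOn.clm_apply ?_ (ContDiffOn.clm_apply ?_ (by fun_prop))
      · exact hΨ.comp (f := fun z : EuclideanSpace ℝ (Fin n) × EuclideanSpace ℝ (Fin n) ×
      EuclideanSpace ℝ (Fin n) × E => z.2.2.2) (by fun_prop) fun z hz => hz.2.1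
      · exact hinv.comp (f := fun z : EuclideanSpace ℝ (Fin n) × EuclideanSpace ℝ (Fin n) ×
      EuclideanSpace ℝ (Fin n) × E => z.2.2.2) (by fun_prop) fun z hz => hz.2
  have hz₀ : (f e₀, y, w, e₀) ∈ Ω :=
    ⟨⟨hx₀, hy⟩, he₀, show (A e₀).IsInvertible by
      simp only [hA, hA₀]; exact ⟨ContinuousLinearEquiv.refl ℝ (EuclideanSpace ℝ (Fin n)), rfl⟩⟩
  obtain ⟨γ, h0, hγ⟩ := exists_smooth_integralCurve hΩo hYs hz₀
  have hγ' : ∀ᶠ t in 𝓝 (0 : ℝ), ∀ᶠ s in 𝓝 t, γ s ∈ Ω ∧ HasDerivAt γ (Y (γ s)) s ∧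
      ContDiffAt ℝ ∞ γ s := eventually_eventually_nhds.2 hγ
  have d1 : ∀ t, HasDerivAt γ (Y (γ t)) t → HasDerivAt (fun t => (γ t).1) (γ t).2.1 t :=
    fun t h => h.fst
  -- The identity is needed as one of germs at each `t`, since it is differentiated once more for
  -- the geodesic equation.
  have e1 : ∀ᶠ t in 𝓝 (0 : ℝ), deriv (fun t => (γ t).1) =ᶠ[𝓝 t] fun s => (γ s).2.1 := by
    filter_upwards [hγ'] with t ht
    filter_upwards [ht] with s hs using (d1 s hs.2.1).deriv
  -- Both curves have derivative `A A⁻¹ ẋ = ẋ` and the same initial value, hence they agree on an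
  -- interval.
  have hfξ : ∀ᶠ t in 𝓝 (0 : ℝ), f (γ t).2.2.2 = (γ t).1 := by
    obtain ⟨δ, hδ, hb⟩ := Metric.eventually_nhds_iff_ball.1 hγ
    have hd : ∀ t ∈ Metric.ball (0 : ℝ) δ,
        HasDerivAt (fun t => f (γ t).2.2.2) (γ t).2.1 t := by
      intro t ht
      obtain ⟨hm, hd, -⟩ := hb t ht
      have h1 : HasFDerivAt f (fderiv ℝ f (γ t).2.2.2) (γ t).2.2.2 :=
        ((hf.contDiffAt (hU.mem_nhds hm.2.1)).differentiableAt (by simp)).hasFDerivAt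
      have h2 : HasDerivAt (fun t => (γ t).2.2.2) (Y (γ t)).2.2.2 t := hd.snd.snd.snd
      refine (HasFDerivAt.comp_hasDerivAt t h1 h2).congr_deriv ?_
      exact ContinuousLinearMap.IsInvertible.apply_inverse_apply (T := A (γ t).2.2.2) hm.2.2 _
    have hEq : (Metric.ball (0 : ℝ) δ).EqOn (fun t => f (γ t).2.2.2) fun t => (γ t).1 := by
      refine Metric.isOpen_ball.eqOn_of_deriv_eq (convex_ball (0 : ℝ) δ).isPreconnected
        (fun t ht => (hd t ht).differentiableAt.differentiableWithinAt)
        (fun t ht => (d1 t (hb t ht).2.1).differentiableAt.differentiableWithinAt)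
        (fun t ht => ?_) (Metric.mem_ball_self hδ) (by simp [h0])
      rw [(hd t ht).deriv, (d1 t (hb t ht).2.1).deriv]
    filter_upwards [Metric.ball_mem_nhds (0 : ℝ) hδ] with t ht using hEq ht
  refine ⟨fun t => (γ t).1, fun t => (γ t).2.2.1, fun t => (γ t).2.2.2, by simp [h0], ?_,
    by simp [h0], by simp [h0], ?_⟩
  · rw [e1.self_of_nhds.self_of_nhds]
    simp [h0]
  filter_upwards [hγ, e1, hfξ] with t ⟨hm, hd, hs⟩ he hft
  have hv : deriv (fun t => (γ t).1) t = (γ t).2.1 := he.self_of_nhds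
  refine ⟨hm.1.1, hm.2.1, hs.fst, hs.snd.snd.fst, hs.snd.snd.snd, ?_, ?_, ?_, hft, ?_⟩
  · rw [hv]; exact hm.1.2
  · rw [he.deriv_eq, hv]
    have h2 : HasDerivAt (fun t => (γ t).2.1) (Y (γ t)).2.1 t := hd.snd.fst
    rw [h2.deriv]
    simp [hY]
  · rw [hv]
    have h2 : HasDerivAt (fun t => (γ t).2.2.1) (Y (γ t)).2.2.1 t := hd.snd.snd.fst
    rw [h2.deriv]
    simp [hY]
  · rw [hv]
    exact hd.snd.snd.snd

end Geodesic

/-! ### Charts -/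

section Chart

variable {F : Type*} [NormedAddCommGroup F] [NormedSpace ℝ F]
  {M : Type*} [TopologicalSpace M] [ChartedSpace F M]

lemma contMDiffAt_extChartAt_symm [IsManifold 𝓘(ℝ, F) ∞ M] {x₀ : M} {p : F}
    (hp : p ∈ (extChartAt 𝓘(ℝ, F) x₀).target) :
    ContMDiffAt 𝓘(ℝ, F) 𝓘(ℝ, F) ∞ (extChartAt 𝓘(ℝ, F) x₀).symm p :=
  (contMDiffOn_extChartAt_symm x₀).contMDiffAt ((isOpen_extChartAt_target x₀).mem_nhds hp)

lemma contMDiffAt_extChartAt_of_mem [IsManifold 𝓘(ℝ, F) ∞ M] {x₀ x : M}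
    (hx : x ∈ (extChartAt 𝓘(ℝ, F) x₀).source) :
    ContMDiffAt 𝓘(ℝ, F) 𝓘(ℝ, F) ∞ (extChartAt 𝓘(ℝ, F) x₀) x :=
  contMDiffAt_extChartAt' (by simpa using hx)

variable [IsManifold 𝓘(ℝ, F) 1 M]

lemma mfderiv_extChartAt_mfderiv_symm {x₀ : M} {p : F}
    (hp : p ∈ (extChartAt 𝓘(ℝ, F) x₀).target) (v : F) :
    mfderiv 𝓘(ℝ, F) 𝓘(ℝ, F) (extChartAt 𝓘(ℝ, F) x₀) ((extChartAt 𝓘(ℝ, F) x₀).symm p)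
      (mfderiv 𝓘(ℝ, F) 𝓘(ℝ, F) (extChartAt 𝓘(ℝ, F) x₀).symm p v) = v := by
  have h := mfderiv_extChartAt_comp_mfderivWithin_extChartAt_symm (I := 𝓘(ℝ, F)) hp
  simp only [modelWithCornersSelf_coe, Set.range_id, mfderivWithin_univ] at h
  exact congrArg (fun T => T v) h

lemma mfderiv_extChartAt_injective {x₀ x : M} (hx : x ∈ (extChartAt 𝓘(ℝ, F) x₀).source) :
    Function.Injective (mfderiv 𝓘(ℝ, F) 𝓘(ℝ, F) (extChartAt 𝓘(ℝ, F) x₀) x) :=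
  (isInvertible_mfderiv_extChartAt hx).injective

lemma deriv_extChartAt_comp {x₀ : M} {c : ℝ → M} {t : ℝ}
    (hc : MDifferentiableAt 𝓘(ℝ, ℝ) 𝓘(ℝ, F) c t)
    (ht : c t ∈ (extChartAt 𝓘(ℝ, F) x₀).source) {v : F}
    (hv : mfderiv 𝓘(ℝ, F) 𝓘(ℝ, F) (extChartAt 𝓘(ℝ, F) x₀) (c t)
        (mfderiv 𝓘(ℝ, ℝ) 𝓘(ℝ, F) c t (1 : ℝ)) = v) :
    HasDerivAt (fun s => extChartAt 𝓘(ℝ, F) x₀ (c s)) v t := by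
  subst hv
  have h1 : MDifferentiableAt 𝓘(ℝ, F) 𝓘(ℝ, F) (extChartAt 𝓘(ℝ, F) x₀) (c t) :=
    mdifferentiableAt_extChartAt (by simpa using ht)
  have h2 := (h1.hasMFDerivAt.comp t hc.hasMFDerivAt).hasFDerivAt
  have h3 : ∀ T : ℝ →L[ℝ] F, HasFDerivAt (fun s => extChartAt 𝓘(ℝ, F) x₀ (c s)) T t →
      HasDerivAt (fun s => extChartAt 𝓘(ℝ, F) x₀ (c s)) (T 1) t := fun T h => h.hasDerivAt
  exact h3 _ h2

lemma mfderiv_extChartAt_symm_comp {x₀ : M} {γ : ℝ → F} {γ' : F} {t : ℝ}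
    (hγ : HasDerivAt γ γ' t) (ht : γ t ∈ (extChartAt 𝓘(ℝ, F) x₀).target) :
    mfderiv 𝓘(ℝ, ℝ) 𝓘(ℝ, F) (fun s => (extChartAt 𝓘(ℝ, F) x₀).symm (γ s)) t (1 : ℝ)
      = mfderiv 𝓘(ℝ, F) 𝓘(ℝ, F) (extChartAt 𝓘(ℝ, F) x₀).symm (γ t) γ' := by
  have h1 : MDifferentiableAt 𝓘(ℝ, F) 𝓘(ℝ, F) (extChartAt 𝓘(ℝ, F) x₀).symm (γ t) := by
    have := mdifferentiableWithinAt_extChartAt_symm (I := 𝓘(ℝ, F)) ht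
    simpa only [modelWithCornersSelf_coe, Set.range_id, mdifferentiableWithinAt_univ] using this
  have h2 := h1.hasMFDerivAt.comp t hγ.hasFDerivAt.hasMFDerivAt
  rw [show (fun s => (extChartAt 𝓘(ℝ, F) x₀).symm (γ s)) = (extChartAt 𝓘(ℝ, F) x₀).symm ∘ γ from rfl,
    h2.mfderiv]
  have : ContinuousLinearMap.toSpanSingleton ℝ γ' (1 : ℝ) = γ' := by simp
  exact congrArg (mfderiv 𝓘(ℝ, F) 𝓘(ℝ, F) (extChartAt 𝓘(ℝ, F) x₀).symm (γ t)) this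

end Chart

/-! ### Finsler metrics in charts -/

section FinslerChart

variable {n : ℕ} {M : Type*} [TopologicalSpace M] [ChartedSpace (EuclideanSpace ℝ (Fin n)) M]

/-- A tangent vector at `x₀` is by convention its coordinate vector in the preferred chart at `x₀`,
so that chart has identity derivative at its centre. Hence no change of coordinates appears at `e`
or at `o`. -/
lemma mfderiv_extChartAt_symm_self [IsManifold (𝓡 n) 1 M] (x₀ : M)
    (v : EuclideanSpace ℝ (Fin n)) :
    mfderiv (𝓡 n) (𝓡 n) (extChartAt (𝓡 n) x₀).symm (extChartAt (𝓡 n) x₀ x₀) v = v := by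
  have h := mfderivWithin_range_extChartAt_symm (I := 𝓡 n) (x := x₀)
  simp only [modelWithCornersSelf_coe, Set.range_id, mfderivWithin_univ] at h
  exact congrArg (fun T => T v) h

/-- The derivative of the inverse chart, as a linear map on the model space. -/
noncomputable def chartSymmDeriv [IsManifold (𝓡 n) 1 M] (x₀ : M) (p : EuclideanSpace ℝ (Fin n)) :
    EuclideanSpace ℝ (Fin n) →ₗ[ℝ]
      TangentSpace (𝓡 n) ((extChartAt (𝓡 n) x₀).symm p) :=
  (mfderiv (𝓡 n) (𝓡 n) (extChartAt (𝓡 n) x₀).symm p).toLinearMap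

lemma localRep_self [IsManifold (𝓡 n) 1 M] (F : TangentBundle (𝓡 n) M → ℝ) (x₀ : M)
    (v : EuclideanSpace ℝ (Fin n)) :
    localRep F x₀ (extChartAt (𝓡 n) x₀ x₀) v = F ⟨x₀, v⟩ := by
  unfold localRep
  rw [mfderiv_extChartAt_symm_self]
  have h : (extChartAt (𝓡 n) x₀).symm (extChartAt (𝓡 n) x₀ x₀) = x₀ := by simp
  have : ∀ (x : M) (hx : x = x₀), F ⟨x, v⟩ = F ⟨x₀, v⟩ := by
    rintro x rfl; rfl
  exact this _ h

/-- Positivity transfers along the injective derivative of the inverse chart, by naturality of the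
fundamental tensor. For smoothness, the map `(p, v) ↦ (φ⁻¹ p, dφ⁻¹ v)` is the inverse of the
trivialization of the tangent bundle at `x₀`, preceded by the inverse chart on the base. -/
lemma IsFinslerMetric.isLocalFinsler [IsManifold (𝓡 n) ∞ M] {F : TangentBundle (𝓡 n) M → ℝ}
    (hF : IsFinslerMetric F) (x₀ : M) :
    IsLocalFinsler (localRep F x₀) (extChartAt (𝓡 n) x₀).target where
  isOpen := isOpen_extChartAt_target x₀
  pos p hp v hv u hu := by
    have hinj : ∀ w : EuclideanSpace ℝ (Fin n), w ≠ 0 → chartSymmDeriv x₀ p w ≠ 0 := by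
      intro w hw h
      apply hw
      have h1 := mfderiv_extChartAt_mfderiv_symm (M := M) hp w
      rw [← h1]
      exact (congrArg _ h).trans (map_zero _)
    have h := hF.strongly_convex _ _ (hinj v hv) _ (hinj u hu)
    rwa [← fundamentalTensor_comp_linearMap] at h
  smooth := by
    have : IsManifold (𝓡 n) (∞ + 1) M := inferInstanceAs (IsManifold (𝓡 n) ∞ M)
    refine ContDiffOn.pow ?_ 2
    rw [← contMDiffOn_iff_contDiffOn]
    let e := trivializationAt (EuclideanSpace ℝ (Fin n)) (TangentSpace (𝓡 n) : M → Type _) x₀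
    have h1 : ContMDiffOn (𝓘(ℝ, EuclideanSpace ℝ (Fin n) × EuclideanSpace ℝ (Fin n)))
        ((𝓡 n).prod 𝓘(ℝ, EuclideanSpace ℝ (Fin n))) ∞
        (fun z : EuclideanSpace ℝ (Fin n) × EuclideanSpace ℝ (Fin n) =>
          ((extChartAt (𝓡 n) x₀).symm z.1, z.2))
        ((extChartAt (𝓡 n) x₀).target ×ˢ {0}ᶜ) := by
      refine ContMDiffOn.prodMk ?_ contDiff_snd.contMDiff.contMDiffOn
      exact (contMDiffOn_extChartAt_symm (I := 𝓡 n) (n := ∞) x₀).comp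
        contDiff_fst.contMDiff.contMDiffOn fun z hz => hz.1
    have hmem : ∀ p ∈ (extChartAt (𝓡 n) x₀).target,
        (extChartAt (𝓡 n) x₀).symm p ∈ (chartAt (EuclideanSpace ℝ (Fin n)) x₀).source :=
      fun p hp => by simpa using (extChartAt (𝓡 n) x₀).map_target hp
    have h2 := (Bundle.Trivialization.contMDiffOn_symm (n := ∞) (IB := 𝓡 n) e).comp h1
      fun z hz => e.mem_target.2 (hmem _ hz.1)
    have h3 : ∀ z ∈ (extChartAt (𝓡 n) x₀).target ×ˢ ({0}ᶜ : Set (EuclideanSpace ℝ (Fin n))),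
        e.toOpenPartialHomeomorph.symm ((extChartAt (𝓡 n) x₀).symm z.1, z.2)
          = ⟨(extChartAt (𝓡 n) x₀).symm z.1, mfderiv (𝓡 n) (𝓡 n) (extChartAt (𝓡 n) x₀).symm z.1 z.2⟩ := by
      intro z hz
      have h4 := TangentBundle.symmL_trivializationAt (I := 𝓡 n) (hmem _ hz.1)
      rw [(extChartAt (𝓡 n) x₀).right_inv hz.1] at h4
      simp only [modelWithCornersSelf_coe, Set.range_id, mfderivWithin_univ] at h4
      have h5 := (e.symmL_apply (R := ℝ) (hmem _ hz.1) z.2).symm.trans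
        (congrArg (fun T => T z.2) h4)
      exact (e.mk_symm (hmem _ hz.1) z.2).symm.trans (congrArg (Bundle.TotalSpace.mk _) h5)
    refine (hF.smooth.comp (h2.congr fun z hz => (h3 z hz).symm) ?_)
    intro z hz h0
    apply hz.2
    have h1 := mfderiv_extChartAt_mfderiv_symm (M := M) hz.1 z.2
    rw [Set.mem_singleton_iff, ← h1]
    exact (congrArg _ h0).trans (map_zero _)

end FinslerChart

/-! ### Left invariant vector fields in a chart at the identity -/

/-- Every tangent space is definitionally the model space, so vectors at different points can be
compared without transport. -/
lemma tangentBundle_mk_eq_iff {F : Type*} [NormedAddCommGroup F] [NormedSpace ℝ F]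
    {M : Type*} [TopologicalSpace M] [ChartedSpace F M] {x y : M} {v w : F} :
    (⟨x, v⟩ : TangentBundle 𝓘(ℝ, F) M) = ⟨y, w⟩ ↔ x = y ∧ v = w := by
  constructor
  · intro h
    exact ⟨congrArg Bundle.TotalSpace.proj h,
      congrArg (fun p : TangentBundle 𝓘(ℝ, F) M => (p.snd : F)) h⟩
  · rintro ⟨rfl, rfl⟩
    rfl

section Group

variable {E : Type*} [NormedAddCommGroup E] [NormedSpace ℝ E]
  {G : Type*} [Group G] [TopologicalSpace G] [ChartedSpace E G]

variable (E G) in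
/-- The coordinates of the identity. -/
noncomputable def chartOne : E := extChartAt 𝓘(ℝ, E) (1 : G) 1

variable (G) in
/-- The left invariant vector fields in the chart at the identity: `leftFrame G ξ v` is the value
at the point with coordinates `ξ` of the left invariant field with value `v` at the identity. -/
noncomputable def leftFrame (ξ : E) : E →L[ℝ] E :=
  fderiv ℝ (fun ζ => extChartAt 𝓘(ℝ, E) (1 : G)
    ((extChartAt 𝓘(ℝ, E) (1 : G)).symm ξ * (extChartAt 𝓘(ℝ, E) (1 : G)).symm ζ)) (chartOne E G)

lemma extChartAt_symm_chartOne : (extChartAt 𝓘(ℝ, E) (1 : G)).symm (chartOne E G) = 1 := by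
  simp [chartOne]

lemma chartOne_mem_target : chartOne E G ∈ (extChartAt 𝓘(ℝ, E) (1 : G)).target :=
  mem_extChartAt_target 1

lemma leftFrame_chartOne : leftFrame G (chartOne E G) = ContinuousLinearMap.id ℝ E := by
  have h : (fun ζ => extChartAt 𝓘(ℝ, E) (1 : G) ((extChartAt 𝓘(ℝ, E) (1 : G)).symm (chartOne E G) *
      (extChartAt 𝓘(ℝ, E) (1 : G)).symm ζ)) =ᶠ[𝓝 (chartOne E G)] id := by
    filter_upwards [(isOpen_extChartAt_target (1 : G)).mem_nhds chartOne_mem_target] with ζ hζ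
    rw [extChartAt_symm_chartOne, one_mul, (extChartAt 𝓘(ℝ, E) (1 : G)).right_inv hζ, id]
  rw [leftFrame, h.fderiv_eq, fderiv_id]

variable [LieGroup 𝓘(ℝ, E) ∞ G]

lemma mfderiv_extChartAt_mulInvariantVectorField {g : G}
    (hg : g ∈ (extChartAt 𝓘(ℝ, E) (1 : G)).source) (v : GroupLieAlgebra 𝓘(ℝ, E) G) :
    mfderiv 𝓘(ℝ, E) 𝓘(ℝ, E) (extChartAt 𝓘(ℝ, E) (1 : G)) g (mulInvariantVectorField v g)
      = leftFrame G (extChartAt 𝓘(ℝ, E) (1 : G) g) v := by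
  -- The chain rule for `ψ ∘ L_g ∘ ψ⁻¹` meets base points such as `g * ψ⁻¹(ψ 1)`, equal to `g` only
  -- propositionally. The derivatives are therefore stated at any point equal to the intended one.
  have hψ : ∀ g' : G, g' = g → HasMFDerivAt 𝓘(ℝ, E) 𝓘(ℝ, E) (extChartAt 𝓘(ℝ, E) (1 : G)) g'
      (mfderiv 𝓘(ℝ, E) 𝓘(ℝ, E) (extChartAt 𝓘(ℝ, E) (1 : G)) g : E →L[ℝ] E) := by
    rintro g' rfl
    exact (mdifferentiableAt_extChartAt (by simpa using hg)).hasMFDerivAt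
  have hL : ∀ h : G, h = 1 → HasMFDerivAt 𝓘(ℝ, E) 𝓘(ℝ, E) (fun x => g * x) h
      (mfderiv 𝓘(ℝ, E) 𝓘(ℝ, E) (fun x => g * x) (1 : G) : E →L[ℝ] E) := by
    rintro h rfl
    exact ((contMDiff_mul_left (I := 𝓘(ℝ, E)) (n := ∞) (a := g)).contMDiffAt.mdifferentiableAt
      (by simp)).hasMFDerivAt
  have hs : HasMFDerivAt 𝓘(ℝ, E) 𝓘(ℝ, E) (extChartAt 𝓘(ℝ, E) (1 : G)).symm (chartOne E G)
      (ContinuousLinearMap.id ℝ E) := by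
    have h1 := ((contMDiffAt_extChartAt_symm (F := E) (x₀ := (1 : G)) chartOne_mem_target).mdifferentiableAt
      (by simp)).hasMFDerivAt
    have h2 := mfderivWithin_range_extChartAt_symm (I := 𝓘(ℝ, E)) (x := (1 : G))
    simp only [modelWithCornersSelf_coe, Set.range_id, mfderivWithin_univ] at h2
    rw [chartOne] at h1 ⊢
    rwa [h2] at h1
  have hc := (((hψ (g * (extChartAt 𝓘(ℝ, E) (1 : G)).symm (chartOne E G))
    (by rw [extChartAt_symm_chartOne, mul_one])).comp _
    (hL _ extChartAt_symm_chartOne)).comp (chartOne E G) hs).hasFDerivAt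
  rw [leftFrame, (extChartAt 𝓘(ℝ, E) (1 : G)).left_inv hg]
  have h3 : ∀ T : E →L[ℝ] E, HasFDerivAt (fun ζ => extChartAt 𝓘(ℝ, E) (1 : G)
      (g * (extChartAt 𝓘(ℝ, E) (1 : G)).symm ζ)) T (chartOne E G) →
      fderiv ℝ (fun ζ => extChartAt 𝓘(ℝ, E) (1 : G)
        (g * (extChartAt 𝓘(ℝ, E) (1 : G)).symm ζ)) (chartOne E G) v = T v :=
    fun T hT => by rw [hT.fderiv]
  exact (h3 _ hc).symm

/-- Multiplication in coordinates is jointly smooth, so its partial derivative in the second factor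
at the identity depends smoothly on the first. -/
lemma contDiffOn_leftFrame :
    ContDiffOn ℝ ∞ (leftFrame G) (extChartAt 𝓘(ℝ, E) (1 : G)).target := by
  intro ξ hξ
  refine ContDiffAt.contDiffWithinAt ?_
  refine ContDiffAt.fderiv (n := ∞) (g := fun _ => chartOne E G) (f := fun ξ ζ =>
    extChartAt 𝓘(ℝ, E) (1 : G) ((extChartAt 𝓘(ℝ, E) (1 : G)).symm ξ *
      (extChartAt 𝓘(ℝ, E) (1 : G)).symm ζ)) ?_ contDiffAt_const le_rfl
  rw [← contMDiffAt_iff_contDiffAt]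
  have h1 : ContMDiffAt 𝓘(ℝ, E × E) 𝓘(ℝ, E) ∞
      (fun z : E × E => (extChartAt 𝓘(ℝ, E) (1 : G)).symm z.1) (ξ, chartOne E G) :=
    (contMDiffAt_extChartAt_symm hξ).comp (ξ, chartOne E G) contDiff_fst.contMDiff.contMDiffAt
  have h2 : ContMDiffAt 𝓘(ℝ, E × E) 𝓘(ℝ, E) ∞
      (fun z : E × E => (extChartAt 𝓘(ℝ, E) (1 : G)).symm z.2) (ξ, chartOne E G) :=
    (contMDiffAt_extChartAt_symm chartOne_mem_target).comp (ξ, chartOne E G)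
      contDiff_snd.contMDiff.contMDiffAt
  refine (contMDiffAt_extChartAt_of_mem ?_).comp (ξ, chartOne E G) (h1.mul h2)
  rw [extChartAt_symm_chartOne, mul_one]
  exact (extChartAt 𝓘(ℝ, E) (1 : G)).map_target hξ

/-- Pulled back to the chart, left invariant fields are `ξ ↦ leftFrame G ξ v`, with value `v` at the
identity. The formula is then the coordinate expression `DW(V) - DV(W)` of the bracket. -/
lemma groupLieAlgebra_bracket_eq (v w : GroupLieAlgebra 𝓘(ℝ, E) G) {v' w' : E}
    (hv : v' = v) (hw : w' = w) :
    (⁅v, w⁆ : GroupLieAlgebra 𝓘(ℝ, E) G)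
      = fderiv ℝ (fun ξ => leftFrame G ξ w') (chartOne E G) v'
        - fderiv ℝ (fun ξ => leftFrame G ξ v') (chartOne E G) w' := by
  have hpull : ∀ (u : GroupLieAlgebra 𝓘(ℝ, E) G) (u' : E), u' = u →
      VectorField.mpullbackWithin 𝓘(ℝ, E) 𝓘(ℝ, E) (extChartAt 𝓘(ℝ, E) (1 : G)).symm
        (mulInvariantVectorField u) (Set.range 𝓘(ℝ, E))
      =ᶠ[𝓝 (chartOne E G)] fun ξ => leftFrame G ξ u' := by
    rintro u u' rfl
    filter_upwards [(isOpen_extChartAt_target (1 : G)).mem_nhds chartOne_mem_target] with ξ hξ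
    have h1 := mfderiv_extChartAt_mulInvariantVectorField
      ((extChartAt 𝓘(ℝ, E) (1 : G)).map_target hξ) u'
    rw [(extChartAt 𝓘(ℝ, E) (1 : G)).right_inv hξ] at h1
    rw [VectorField.mpullbackWithin_apply, ← h1]
    have h2 := mfderivWithin_extChartAt_symm_comp_mfderiv_extChartAt (I := 𝓘(ℝ, E)) hξ
    have h3 := mfderiv_extChartAt_comp_mfderivWithin_extChartAt_symm (I := 𝓘(ℝ, E)) hξ
    rw [ContinuousLinearMap.inverse_eq h2 h3]
  rw [GroupLieAlgebra.bracket_def, ← VectorField.mlieBracketWithin_univ,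
    VectorField.mlieBracketWithin_apply]
  have hi : ∀ T : E →L[ℝ] E, T = ContinuousLinearMap.id ℝ E → ∀ X, T.inverse X = X := by
    rintro _ rfl X
    simp
  refine (hi _ (mfderiv_extChartAt_self (I := 𝓘(ℝ, E)) (x := (1 : G))) _).trans ?_
  have h4 := Filter.EventuallyEq.lieBracket_vectorField_eq (𝕜 := ℝ) (hpull v v' hv) (hpull w w' hw)
  have h5 : ∀ (P Q : E → E) (s : Set E), s = Set.univ →
      VectorField.lieBracketWithin ℝ P Q s (chartOne E G)
        = VectorField.lieBracket ℝ P Q (chartOne E G) := by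
    rintro P Q _ rfl
    rw [VectorField.lieBracketWithin_univ]
  refine (h5 _ _ _ (by simp)).trans ?_
  refine h4.trans ?_
  rw [VectorField.lieBracket, leftFrame_chartOne]
  rfl

end Group

/-! ### Sections and fibres of submersions -/

namespace Manifold

universe u

variable {E : Type u} {F : Type*} [NormedAddCommGroup E] [NormedSpace ℝ E]
  [NormedAddCommGroup F] [NormedSpace ℝ F]
  {M N : Type*} [TopologicalSpace M] [ChartedSpace E M] [TopologicalSpace N] [ChartedSpace F N]
  {f : M → N} {x : M}

/-- The local normal form as a linear projection `F × K → F`; local sections and curves in the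
fibres are both read off from it. -/
lemma IsSubmersionAt.exists_charts (h : IsSubmersionAt 𝓘(ℝ, E) 𝓘(ℝ, F) ∞ f x) :
    ∃ (K : Type u) (_ : NormedAddCommGroup K) (_ : NormedSpace ℝ K) (e : E ≃L[ℝ] F × K)
      (D : OpenPartialHomeomorph M E) (C : OpenPartialHomeomorph N F),
      x ∈ D.source ∧ D ∈ IsManifold.maximalAtlas 𝓘(ℝ, E) ∞ M ∧
      C ∈ IsManifold.maximalAtlas 𝓘(ℝ, F) ∞ N ∧ (∀ y ∈ D.source, f y ∈ C.source) ∧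
      ∀ y ∈ D.source, C (f y) = (e (D y)).1 := by
  obtain ⟨K, i1, i2, h⟩ := h
  refine ⟨K, i1, i2, h.equiv, h.domChart, h.codChart, h.mem_domChart_source,
    h.domChart_mem_maximalAtlas, h.codChart_mem_maximalAtlas,
    h.source_subset_preimage_source, fun y hy => ?_⟩
  have h1 : h.domChart y ∈ (h.domChart.extend 𝓘(ℝ, E)).target := by
    simpa using h.domChart.map_source hy
  simpa [h.domChart.left_inv hy] using h.writtenInCharts h1

/-- In the normal form, keep the `K`-coordinate of `x` fixed and let the `F`-coordinate vary. -/
lemma IsSubmersionAt.exists_section (h : IsSubmersionAt 𝓘(ℝ, E) 𝓘(ℝ, F) ∞ f x) :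
    ∃ s : N → M, s (f x) = x ∧ MDifferentiableAt 𝓘(ℝ, F) 𝓘(ℝ, E) s (f x) ∧
      ∀ᶠ y in 𝓝 (f x), f (s y) = y := by
  obtain ⟨K, i1, i2, e, D, C, hx, hD, hC, hs, hfe⟩ := h.exists_charts
  have h0 : e.symm (C (f x), (e (D x)).2) = D x := by
    rw [hfe x hx]; simp
  have hcont : ContinuousAt (fun y => e.symm (C y, (e (D x)).2)) (f x) :=
    e.symm.continuous.continuousAt.comp
      ((C.continuousAt (hs x hx)).prodMk continuousAt_const)
  refine ⟨fun y => D.symm (e.symm (C y, (e (D x)).2)), by simp only [h0, D.left_inv hx], ?_, ?_⟩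
  · have h1 : MDifferentiableAt 𝓘(ℝ, F) 𝓘(ℝ, F) C (f x) :=
      (contMDiffAt_of_mem_maximalAtlas hC (hs x hx)).mdifferentiableAt (by simp)
    have h2 : MDifferentiableAt 𝓘(ℝ, E) 𝓘(ℝ, E) D.symm (e.symm (C (f x), (e (D x)).2)) := by
      rw [h0]
      exact (contMDiffAt_symm_of_mem_maximalAtlas hD (D.map_source hx)).mdifferentiableAt (by simp)
    have h3 : MDifferentiableAt 𝓘(ℝ, F) 𝓘(ℝ, E) (fun p : F => e.symm (p, (e (D x)).2)) (C (f x)) := by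
      rw [mdifferentiableAt_iff_differentiableAt]
      fun_prop
    exact h2.comp (f x) (h3.comp (f x) h1)
  · have h1 : ∀ᶠ y in 𝓝 (f x), e.symm (C y, (e (D x)).2) ∈ D.target :=
      hcont.eventually_mem (D.open_target.mem_nhds (by simpa only [h0] using D.map_source hx))
    filter_upwards [h1, C.open_source.mem_nhds (hs x hx)] with y hy hyC
    refine C.injOn (hs _ (D.map_target hy)) hyC ?_
    rw [hfe _ (D.map_target hy), D.right_inv hy]
    simp

lemma IsSubmersionAt.mfderiv_surjective (h : IsSubmersionAt 𝓘(ℝ, E) 𝓘(ℝ, F) ∞ f x)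
    (hf : MDifferentiableAt 𝓘(ℝ, E) 𝓘(ℝ, F) f x) :
    Function.Surjective (mfderiv 𝓘(ℝ, E) 𝓘(ℝ, F) f x) := by
  obtain ⟨s, hsx, hs, hfs⟩ := h.exists_section
  intro v
  have hf' : ∀ x', x' = x → HasMFDerivAt 𝓘(ℝ, E) 𝓘(ℝ, F) f x'
      (mfderiv 𝓘(ℝ, E) 𝓘(ℝ, F) f x : E →L[ℝ] F) := by
    rintro x' rfl
    exact hf.hasMFDerivAt
  have h1 := ((hf' _ hsx).comp (f x) hs.hasMFDerivAt).mfderiv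
  have h2 : f ∘ s =ᶠ[𝓝 (f x)] id := hfs
  rw [h2.mfderiv_eq] at h1
  have h3 := congrArg (fun T : F →L[ℝ] F => T v) (h1.symm.trans mfderiv_id)
  exact ⟨_, h3⟩

/-- In the normal form a vector killed by the derivative has zero `F`-component, so the straight
line in its direction stays in the fibre. -/
lemma IsSubmersionAt.exists_fiber_curve [IsManifold 𝓘(ℝ, E) 1 M]
    (h : IsSubmersionAt 𝓘(ℝ, E) 𝓘(ℝ, F) ∞ f x)
    (hf : MDifferentiableAt 𝓘(ℝ, E) 𝓘(ℝ, F) f x) {v : TangentSpace 𝓘(ℝ, E) x}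
    (hv : mfderiv 𝓘(ℝ, E) 𝓘(ℝ, F) f x v = 0) :
    ∃ γ : ℝ → M, γ 0 = x ∧ (∀ᶠ t in 𝓝 0, ContMDiffAt 𝓘(ℝ, ℝ) 𝓘(ℝ, E) ∞ γ t) ∧
      (∀ᶠ t in 𝓝 0, f (γ t) = f x) ∧ (mfderiv 𝓘(ℝ, ℝ) 𝓘(ℝ, E) γ 0 (1 : ℝ) : E) = v := by
  obtain ⟨K, i1, i2, e, D, C, hx, hD, hC, hs, hfe⟩ := h.exists_charts
  obtain ⟨d, hd⟩ : ∃ d : E, d = mfderiv 𝓘(ℝ, E) 𝓘(ℝ, E) D x v := ⟨_, rfl⟩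
  have hDd : HasMFDerivAt 𝓘(ℝ, E) 𝓘(ℝ, E) D x (mfderiv 𝓘(ℝ, E) 𝓘(ℝ, E) D x) :=
    ((contMDiffAt_of_mem_maximalAtlas hD hx).mdifferentiableAt (by simp)).hasMFDerivAt
  have hde : (e d).1 = 0 := by
    have hCd : HasMFDerivAt 𝓘(ℝ, F) 𝓘(ℝ, F) C (f x) (mfderiv 𝓘(ℝ, F) 𝓘(ℝ, F) C (f x)) :=
      ((contMDiffAt_of_mem_maximalAtlas hC (hs x hx)).mdifferentiableAt (by simp)).hasMFDerivAt
    have h1 := (hCd.comp x hf.hasMFDerivAt).mfderiv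
    have h2 := (((ContinuousLinearMap.fst ℝ F K ∘L (e : E →L[ℝ] F × K)).hasFDerivAt
      (x := D x)).hasMFDerivAt.comp x hDd).mfderiv
    have h3 : C ∘ f =ᶠ[𝓝 x] (ContinuousLinearMap.fst ℝ F K ∘L (e : E →L[ℝ] F × K)) ∘ D := by
      filter_upwards [D.open_source.mem_nhds hx] with y hy using hfe y hy
    rw [h3.mfderiv_eq] at h1
    have h4 := congrArg (fun T : E →L[ℝ] F => T v) (h2.symm.trans h1)
    rw [hd]
    refine Eq.trans h4 ?_
    exact (congrArg (mfderiv 𝓘(ℝ, F) 𝓘(ℝ, F) C (f x)) hv).trans (map_zero _)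
  have hline : ∀ t : ℝ, HasDerivAt (fun t : ℝ => D x + t • d) d t := fun t => by
    simpa using ((hasDerivAt_id t).smul_const d).const_add (D x)
  have htarget : ∀ᶠ t : ℝ in 𝓝 0, D x + t • d ∈ D.target :=
    (hline 0).continuousAt.eventually_mem
      (D.open_target.mem_nhds (by simpa using D.map_source hx))
  refine ⟨fun t => D.symm (D x + t • d), by simp [D.left_inv hx], ?_, ?_, ?_⟩
  · filter_upwards [htarget] with t ht
    refine (contMDiffAt_symm_of_mem_maximalAtlas hD ht).comp t
      (f := fun t : ℝ => D x + t • d) (ContDiffAt.contMDiffAt ?_)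
    fun_prop
  · filter_upwards [htarget] with t ht
    refine C.injOn (hs _ (D.map_target ht)) (hs x hx) ?_
    rw [hfe _ (D.map_target ht), D.right_inv ht, hfe x hx, map_add, map_smul, Prod.fst_add,
      Prod.smul_fst, hde, smul_zero, add_zero]
  · have hmd : D.MDifferentiable 𝓘(ℝ, E) 𝓘(ℝ, E) :=
      ⟨fun y hy => ((contMDiffAt_of_mem_maximalAtlas hD hy).mdifferentiableAt
        (by simp)).mdifferentiableWithinAt,
       fun y hy => ((contMDiffAt_symm_of_mem_maximalAtlas hD hy).mdifferentiableAt
        (by simp)).mdifferentiableWithinAt⟩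
    have h1 : ∀ p, p = D x → HasMFDerivAt 𝓘(ℝ, E) 𝓘(ℝ, E) D.symm p
        (mfderiv 𝓘(ℝ, E) 𝓘(ℝ, E) D.symm (D x) : E →L[ℝ] E) := by
      rintro p rfl
      exact (hmd.mdifferentiableAt_symm (D.map_source hx)).hasMFDerivAt
    have h2 := ((h1 (D x + (0 : ℝ) • d) (by simp)).comp (0 : ℝ)
      (hline 0).hasFDerivAt.hasMFDerivAt).mfderiv
    have h3 := congrArg (fun T : ℝ →L[ℝ] E => T 1) h2
    have h4 : ∀ T : E →L[ℝ] E, (T ∘L ContinuousLinearMap.toSpanSingleton ℝ d) 1 = T d := by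
      intro T; simp
    refine (h3.trans (h4 _)).trans ?_
    rw [hd]
    exact congrArg (fun T : E →L[ℝ] E => T v) (hmd.symm_comp_deriv hx)

end Manifold

/-! ### The projection of a coset space in charts -/

section CosetChart

variable {E : Type*} [NormedAddCommGroup E] [NormedSpace ℝ E]
  {G : Type*} [Group G] [TopologicalSpace G] [ChartedSpace E G]
  {H : Subgroup G} {n : ℕ} [ChartedSpace (EuclideanSpace ℝ (Fin n)) (G ⧸ H)]

variable (H n) in
/-- The projection `G → G/H` in the charts at the identity and at the origin. -/
noncomputable def cosetCoord (ξ : E) : EuclideanSpace ℝ (Fin n) :=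
  extChartAt (𝓡 n) (cosetOrigin H) (cosetProj H ((extChartAt 𝓘(ℝ, E) (1 : G)).symm ξ))

variable (E H n) in
/-- The domain of the projection `G → G/H` in the charts at the identity and at the origin. -/
def cosetDomain : Set E :=
  (extChartAt 𝓘(ℝ, E) (1 : G)).target ∩ (extChartAt 𝓘(ℝ, E) (1 : G)).symm ⁻¹'
    (cosetProj H ⁻¹' (extChartAt (𝓡 n) (cosetOrigin H)).source)

lemma chartOne_mem_cosetDomain : chartOne E G ∈ cosetDomain E H n := by
  refine ⟨chartOne_mem_target, ?_⟩
  rw [Set.mem_preimage, Set.mem_preimage, extChartAt_symm_chartOne]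
  exact mem_extChartAt_source _

lemma cosetCoord_chartOne :
    cosetCoord H n (chartOne E G) = extChartAt (𝓡 n) (cosetOrigin H) (cosetOrigin H) := by
  rw [cosetCoord, extChartAt_symm_chartOne]

lemma isOpen_cosetDomain (hπ : ContMDiff 𝓘(ℝ, E) (𝓡 n) ∞ (cosetProj H)) :
    IsOpen (cosetDomain E H n) :=
  (continuousOn_extChartAt_symm (1 : G)).isOpen_inter_preimage (isOpen_extChartAt_target _)
    ((isOpen_extChartAt_source _).preimage hπ.continuous)

variable [LieGroup 𝓘(ℝ, E) ∞ G]

/-- Near the origin the translation factors as `π ∘ L_g ∘ s` with a local section `s`, so its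
differentiability is inherited from the group. -/
lemma mdifferentiableAt_smul_origin (hπ : ContMDiff 𝓘(ℝ, E) (𝓡 n) ∞ (cosetProj H))
    (hs : Manifold.IsSubmersionAt 𝓘(ℝ, E) (𝓡 n) ∞ (cosetProj H) 1) (g : G) :
    MDifferentiableAt (𝓡 n) (𝓡 n) (fun x : G ⧸ H => g • x) (cosetOrigin H) := by
  obtain ⟨s, hs1, hsd, hπs⟩ := hs.exists_section
  have h1 : MDifferentiableAt 𝓘(ℝ, E) (𝓡 n) (cosetProj H ∘ fun x => g * x) (s (cosetOrigin H)) :=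
    ((hπ _).mdifferentiableAt (by simp)).comp _
      ((contMDiff_mul_left (I := 𝓘(ℝ, E)) (n := ∞) (a := g)).contMDiffAt.mdifferentiableAt
        (by simp))
  refine (h1.comp (cosetOrigin H) hsd).congr_of_eventuallyEq ?_
  filter_upwards [hπs] with x hx
  change g • x = g • cosetProj H (s x)
  rw [hx]

/-- The derivative at the identity of the equivariance `g • π(x) = π(g x)`. -/
lemma mfderiv_smul_mfderiv_cosetProj (hπ : ContMDiff 𝓘(ℝ, E) (𝓡 n) ∞ (cosetProj H))
    (hs : Manifold.IsSubmersionAt 𝓘(ℝ, E) (𝓡 n) ∞ (cosetProj H) 1) (g : G)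
    (v : GroupLieAlgebra 𝓘(ℝ, E) G) :
    (mfderiv (𝓡 n) (𝓡 n) (fun x : G ⧸ H => g • x) (cosetOrigin H)
      (mfderiv 𝓘(ℝ, E) (𝓡 n) (cosetProj H) 1 v) : EuclideanSpace ℝ (Fin n))
      = mfderiv 𝓘(ℝ, E) (𝓡 n) (cosetProj H) g (mulInvariantVectorField v g) := by
  have h1 := ((mdifferentiableAt_smul_origin hπ hs g).hasMFDerivAt.comp (1 : G)
    ((hπ 1).mdifferentiableAt (by simp)).hasMFDerivAt).mfderiv
  have hp : ∀ g', g' = g → HasMFDerivAt 𝓘(ℝ, E) (𝓡 n) (cosetProj H) g'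
      (mfderiv 𝓘(ℝ, E) (𝓡 n) (cosetProj H) g : E →L[ℝ] EuclideanSpace ℝ (Fin n)) := by
    rintro g' rfl
    exact ((hπ g').mdifferentiableAt (by simp)).hasMFDerivAt
  have h2 := ((hp (g * 1) (mul_one g)).comp (1 : G)
    ((contMDiff_mul_left (I := 𝓘(ℝ, E)) (n := ∞) (a := g)).contMDiffAt.mdifferentiableAt
      (by simp)).hasMFDerivAt).mfderiv
  have h3 : (fun x : G ⧸ H => g • x) ∘ cosetProj H = cosetProj H ∘ fun x => g * x := rfl
  rw [h3] at h1
  exact congrArg (fun T : E →L[ℝ] EuclideanSpace ℝ (Fin n) => T v) (h1.symm.trans h2)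

/-- The subalgebra `𝔥` is the kernel of `π_*`. The projection is constant along curves in `H`;
conversely, a vertical vector is the velocity of a curve in the fibre through the identity, which is
`H`. -/
lemma mem_subgroupLieAlgebra_iff (hπ : ContMDiff 𝓘(ℝ, E) (𝓡 n) ∞ (cosetProj H))
    (hs : Manifold.IsSubmersionAt 𝓘(ℝ, E) (𝓡 n) ∞ (cosetProj H) 1)
    (v : GroupLieAlgebra 𝓘(ℝ, E) G) :
    v ∈ (subgroupLieAlgebra H : Submodule ℝ (GroupLieAlgebra 𝓘(ℝ, E) G)) ↔
      mfderiv 𝓘(ℝ, E) (𝓡 n) (cosetProj H) 1 v = 0 := by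
  constructor
  · intro hv
    change v ∈ (mfderiv 𝓘(ℝ, E) (𝓡 n) (cosetProj H) 1).toLinearMap.ker
    refine (Submodule.span_le.2 ?_ : subgroupLieAlgebra H ≤ _) hv
    rintro v ⟨γ, hγ, hγH, hγ1⟩
    obtain ⟨h0, hv⟩ := tangentBundle_mk_eq_iff.1 hγ1
    have hd := (hγ.self_of_nhds.mdifferentiableAt (by simp)).hasMFDerivAt
    have hp : ∀ g', g' = 1 → HasMFDerivAt 𝓘(ℝ, E) (𝓡 n) (cosetProj H) g'
        (mfderiv 𝓘(ℝ, E) (𝓡 n) (cosetProj H) 1 : E →L[ℝ] EuclideanSpace ℝ (Fin n)) := by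
      rintro g' rfl
      exact ((hπ 1).mdifferentiableAt (by simp)).hasMFDerivAt
    have h1 := ((hp (γ 0) h0).comp (0 : ℝ) hd).mfderiv
    have h2 : cosetProj H ∘ γ =ᶠ[𝓝 0] fun _ => cosetOrigin H := by
      filter_upwards [hγH] with t ht
      exact (QuotientGroup.eq.2 (by simpa using ht) : ((1 : G) : G ⧸ H) = γ t).symm
    rw [h2.mfderiv_eq] at h1
    have h3 := congrArg (fun T : ℝ →L[ℝ] EuclideanSpace ℝ (Fin n) => T 1)
      (h1.symm.trans mfderiv_const)
    rw [← hv]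
    exact h3
  · intro hv
    obtain ⟨γ, h0, hγ, hγH, hγ1⟩ :=
      hs.exists_fiber_curve ((hπ 1).mdifferentiableAt (by simp)) hv
    refine Submodule.subset_span ⟨γ, hγ, ?_, tangentBundle_mk_eq_iff.2 ⟨h0, hγ1⟩⟩
    filter_upwards [hγH] with t ht
    simpa using (QuotientGroup.eq.1 (ht.symm : ((1 : G) : G ⧸ H) = γ t))

variable [IsManifold (𝓡 n) ∞ (G ⧸ H)]

lemma contDiffOn_cosetCoord (hπ : ContMDiff 𝓘(ℝ, E) (𝓡 n) ∞ (cosetProj H)) :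
    ContDiffOn ℝ ∞ (cosetCoord H n : E → _) (cosetDomain E H n) := by
  intro ξ hξ
  refine ContDiffAt.contDiffWithinAt ?_
  rw [← contMDiffAt_iff_contDiffAt]
  exact (contMDiffAt_extChartAt_of_mem hξ.2).comp ξ
    ((hπ _).comp ξ (contMDiffAt_extChartAt_symm hξ.1))

lemma mfderiv_cosetProj_eq (hπ : ContMDiff 𝓘(ℝ, E) (𝓡 n) ∞ (cosetProj H)) {g : G}
    (hg : g ∈ (extChartAt 𝓘(ℝ, E) (1 : G)).source)
    (hg' : cosetProj H g ∈ (extChartAt (𝓡 n) (cosetOrigin H)).source)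
    (v : TangentSpace 𝓘(ℝ, E) g) {v' : E}
    (hv : mfderiv 𝓘(ℝ, E) 𝓘(ℝ, E) (extChartAt 𝓘(ℝ, E) (1 : G)) g v = v') :
    mfderiv (𝓡 n) (𝓡 n) (extChartAt (𝓡 n) (cosetOrigin H)) (cosetProj H g)
      (mfderiv 𝓘(ℝ, E) (𝓡 n) (cosetProj H) g v)
      = fderiv ℝ (cosetCoord H n) (extChartAt 𝓘(ℝ, E) (1 : G) g) v' := by
  subst hv
  have hmem : extChartAt 𝓘(ℝ, E) (1 : G) g ∈ cosetDomain E H n := by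
    refine ⟨(extChartAt 𝓘(ℝ, E) (1 : G)).map_source hg, ?_⟩
    rwa [Set.mem_preimage, Set.mem_preimage, (extChartAt 𝓘(ℝ, E) (1 : G)).left_inv hg]
  have h1 := ((mdifferentiableAt_extChartAt (I := 𝓡 n)
    (by simpa using hg')).hasMFDerivAt.comp g
    ((hπ g).mdifferentiableAt (by simp)).hasMFDerivAt).mfderiv
  have h2 := ((((contDiffOn_cosetCoord hπ).contDiffAt
    ((isOpen_cosetDomain hπ).mem_nhds hmem)).differentiableAt
      (by simp)).hasFDerivAt.hasMFDerivAt.comp g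
    (mdifferentiableAt_extChartAt (I := 𝓘(ℝ, E)) (x := (1 : G))
      (by simpa using hg)).hasMFDerivAt).mfderiv
  have h3 : extChartAt (𝓡 n) (cosetOrigin H) ∘ cosetProj H =ᶠ[𝓝 g]
      cosetCoord H n ∘ extChartAt 𝓘(ℝ, E) (1 : G) := by
    filter_upwards [(isOpen_extChartAt_source (I := 𝓘(ℝ, E)) (1 : G)).mem_nhds hg] with g' hg'
    simp only [Function.comp, cosetCoord, (extChartAt 𝓘(ℝ, E) (1 : G)).left_inv hg']
  rw [h3.mfderiv_eq] at h1
  exact congrArg (fun T : E →L[ℝ] EuclideanSpace ℝ (Fin n) => T v) (h1.symm.trans h2)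

lemma mfderiv_cosetProj_mulInvariantVectorField
    (hπ : ContMDiff 𝓘(ℝ, E) (𝓡 n) ∞ (cosetProj H)) {g : G}
    (hg : g ∈ (extChartAt 𝓘(ℝ, E) (1 : G)).source)
    (hg' : cosetProj H g ∈ (extChartAt (𝓡 n) (cosetOrigin H)).source)
    (v : GroupLieAlgebra 𝓘(ℝ, E) G) :
    mfderiv (𝓡 n) (𝓡 n) (extChartAt (𝓡 n) (cosetOrigin H)) (cosetProj H g)
      (mfderiv 𝓘(ℝ, E) (𝓡 n) (cosetProj H) g (mulInvariantVectorField v g))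
      = fderiv ℝ (cosetCoord H n) (extChartAt 𝓘(ℝ, E) (1 : G) g)
        (leftFrame G (extChartAt 𝓘(ℝ, E) (1 : G) g) v) :=
  mfderiv_cosetProj_eq hπ hg hg' _ (mfderiv_extChartAt_mulInvariantVectorField hg v)

lemma mfderiv_cosetProj_one (hπ : ContMDiff 𝓘(ℝ, E) (𝓡 n) ∞ (cosetProj H))
    (v : GroupLieAlgebra 𝓘(ℝ, E) G) :
    (mfderiv 𝓘(ℝ, E) (𝓡 n) (cosetProj H) 1 v : EuclideanSpace ℝ (Fin n))
      = fderiv ℝ (cosetCoord H n) (chartOne E G) v := by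
  have h1 : (mfderiv 𝓘(ℝ, E) 𝓘(ℝ, E) (extChartAt 𝓘(ℝ, E) (1 : G)) 1 v : E) = v :=
    congrArg (fun T : E →L[ℝ] E => T v) (mfderiv_extChartAt_self (I := 𝓘(ℝ, E)) (x := (1 : G)))
  have h2 := mfderiv_cosetProj_eq hπ (mem_extChartAt_source (1 : G))
    (mem_extChartAt_source (cosetOrigin H)) v h1
  have h3 := congrArg (fun T : EuclideanSpace ℝ (Fin n) →L[ℝ] EuclideanSpace ℝ (Fin n) =>
    T (mfderiv 𝓘(ℝ, E) (𝓡 n) (cosetProj H) 1 v))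
    (mfderiv_extChartAt_self (I := 𝓡 n) (x := cosetOrigin H))
  exact h3.symm.trans h2

end CosetChart

/-! ### Geodesics and parallel fields in charts -/

section GeodesicChart

variable {n : ℕ} {M : Type*} [TopologicalSpace M] [ChartedSpace (EuclideanSpace ℝ (Fin n)) M]
  {F : TangentBundle (𝓡 n) M → ℝ} {c : ℝ → M} {x₀ : M}

lemma eventually_mem_target_of_continuousAt {x : ℝ → EuclideanSpace ℝ (Fin n)}
    (hx : ContinuousAt x 0)
    (hx0 : x 0 = extChartAt (𝓡 n) x₀ x₀) :
    ∀ᶠ t in 𝓝 (0 : ℝ), x t ∈ (extChartAt (𝓡 n) x₀).target :=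
  hx.eventually_mem (by rw [hx0]; exact extChartAt_target_mem_nhds x₀)

lemma localCurve_extChartAt_symm {x : ℝ → EuclideanSpace ℝ (Fin n)} (hx : ContinuousAt x 0)
    (hx0 : x 0 = extChartAt (𝓡 n) x₀ x₀) :
    localCurve x₀ (fun t => (extChartAt (𝓡 n) x₀).symm (x t)) =ᶠ[𝓝 0] x := by
  filter_upwards [eventually_mem_target_of_continuousAt hx hx0] with t ht
  exact (extChartAt (𝓡 n) x₀).right_inv ht

variable [IsManifold (𝓡 n) ∞ M]

lemma IsGeodesicAt.eventually_localCurve (h : IsGeodesicAt F c 0) (h0 : c 0 = x₀) :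
    ∀ᶠ t in 𝓝 (0 : ℝ), c t ∈ (extChartAt (𝓡 n) x₀).source ∧
      ContDiffAt ℝ ∞ (localCurve (n := n) x₀ c) t ∧
      HasDerivAt (localCurve (n := n) x₀ c)
        (mfderiv (𝓡 n) (𝓡 n) (extChartAt (𝓡 n) x₀) (c t) (curveVelocity c t)) t ∧
      deriv (deriv (localCurve (n := n) x₀ c)) t
        + (2 : ℝ) • sprayVec (localRep F x₀) (localCurve x₀ c t) (deriv (localCurve x₀ c) t)
        = 0 := by
  subst h0
  obtain ⟨h1, -, h3⟩ := h
  have h4 : ∀ᶠ t in 𝓝 (0 : ℝ), c t ∈ (extChartAt (𝓡 n) (c 0)).source :=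
    h1.self_of_nhds.continuousAt.eventually_mem (extChartAt_source_mem_nhds (c 0))
  filter_upwards [h1, h3, h4] with t h1 h3 h4
  refine ⟨h4, ?_, deriv_extChartAt_comp (h1.mdifferentiableAt (by simp)) h4 rfl, ?_⟩
  · rw [← contMDiffAt_iff_contDiffAt]
    exact (contMDiffAt_extChartAt_of_mem h4).comp t h1
  · ext i
    exact h3 i

lemma deriv_localCurve_zero (hc : MDifferentiableAt 𝓘(ℝ, ℝ) (𝓡 n) c 0)
    {v : TangentSpace (𝓡 n) x₀}
    (h0 : (⟨c 0, curveVelocity c 0⟩ : TangentBundle (𝓡 n) M) = ⟨x₀, v⟩) :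
    deriv (localCurve (n := n) x₀ c) 0 = v := by
  obtain ⟨h0, hv⟩ := tangentBundle_mk_eq_iff.1 h0
  subst h0
  refine (deriv_extChartAt_comp hc (mem_extChartAt_source _) ?_).deriv
  exact (congrArg (fun T : EuclideanSpace ℝ (Fin n) →L[ℝ] EuclideanSpace ℝ (Fin n) =>
    T (curveVelocity c 0)) (mfderiv_extChartAt_self (I := 𝓡 n) (x := c 0))).trans hv

lemma IsLinearlyParallelAt.eventually_localField {X : ∀ t, TangentSpace (𝓡 n) (c t)}
    (h : IsLinearlyParallelAt F c X 0) {w : TangentSpace (𝓡 n) x₀}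
    (h0 : (⟨c 0, X 0⟩ : TangentBundle (𝓡 n) M) = ⟨x₀, w⟩) :
    localField x₀ c X 0 = w ∧ ∀ᶠ t in 𝓝 (0 : ℝ), ContDiffAt ℝ ∞ (localField x₀ c X) t ∧
      deriv (localField x₀ c X) t + connectionVec (localRep F x₀) (localCurve x₀ c t)
        (deriv (localCurve x₀ c) t) (localField x₀ c X t) = 0 := by
  obtain ⟨h0, hv⟩ := tangentBundle_mk_eq_iff.1 h0
  subst h0
  constructor
  · exact (congrArg (fun T : EuclideanSpace ℝ (Fin n) →L[ℝ] EuclideanSpace ℝ (Fin n) =>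
      T (X 0)) (mfderiv_extChartAt_self (I := 𝓡 n) (x := c 0))).trans hv
  · filter_upwards [h.1, h.2] with t h1 h2
    refine ⟨h1, ?_⟩
    ext i
    exact h2 i

variable {x X : ℝ → EuclideanSpace ℝ (Fin n)}

/-- Being a geodesic near time 0 is tested in the single chart at `c 0 = x₀`, so a coordinate
solution needs no change of charts. -/
lemma isGeodesicAt_extChartAt_symm (hx0 : x 0 = extChartAt (𝓡 n) x₀ x₀)
    (hx : ∀ᶠ t in 𝓝 (0 : ℝ), ContDiffAt ℝ ∞ x t ∧ deriv x t ≠ 0 ∧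
      deriv (deriv x) t + (2 : ℝ) • sprayVec (localRep F x₀) (x t) (deriv x t) = 0) :
    IsGeodesicAt F (fun t => (extChartAt (𝓡 n) x₀).symm (x t)) 0 := by
  have hc := hx.self_of_nhds.1.continuousAt
  have h0 : (extChartAt (𝓡 n) x₀).symm (x 0) = x₀ := by rw [hx0]; simp
  have h1 := localCurve_extChartAt_symm hc hx0
  unfold IsGeodesicAt
  simp only [h0]
  refine ⟨?_, ?_, ?_⟩
  · filter_upwards [hx, eventually_mem_target_of_continuousAt hc hx0] with t ht ht'
    exact (contMDiffAt_extChartAt_symm ht').comp t ht.1.contMDiffAt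
  · filter_upwards [hx, h1.deriv] with t ht ht'
    rw [ht']
    exact ht.2.1
  · filter_upwards [hx, h1, h1.deriv, h1.deriv.deriv] with t ht h1 h2 h3 i
    rw [h1, h2, h3]
    exact congrArg (fun v : EuclideanSpace ℝ (Fin n) => v i) ht.2.2

lemma curveVelocity_extChartAt_symm_zero (hx0 : x 0 = extChartAt (𝓡 n) x₀ x₀)
    {v : TangentSpace (𝓡 n) x₀} (hx : HasDerivAt x v 0) :
    (⟨(extChartAt (𝓡 n) x₀).symm (x 0),
      curveVelocity (fun t => (extChartAt (𝓡 n) x₀).symm (x t)) 0⟩ : TangentBundle (𝓡 n) M)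
      = ⟨x₀, v⟩ := by
  refine tangentBundle_mk_eq_iff.2 ⟨by rw [hx0]; simp, ?_⟩
  refine (mfderiv_extChartAt_symm_comp hx
    (by rw [hx0]; exact mem_extChartAt_target x₀)).trans ?_
  have : ∀ p, p = extChartAt (𝓡 n) x₀ x₀ →
      (mfderiv (𝓡 n) (𝓡 n) (extChartAt (𝓡 n) x₀).symm p v : EuclideanSpace ℝ (Fin n)) = v := by
    rintro _ rfl
    exact mfderiv_extChartAt_symm_self x₀ v
  exact this _ hx0

lemma field_extChartAt_symm_zero (hx0 : x 0 = extChartAt (𝓡 n) x₀ x₀)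
    {w : TangentSpace (𝓡 n) x₀} (hX : X 0 = w) :
    (⟨(extChartAt (𝓡 n) x₀).symm (x 0),
      mfderiv (𝓡 n) (𝓡 n) (extChartAt (𝓡 n) x₀).symm (x 0) (X 0)⟩ : TangentBundle (𝓡 n) M)
      = ⟨x₀, w⟩ := by
  refine tangentBundle_mk_eq_iff.2 ⟨by rw [hx0]; simp, ?_⟩
  have : ∀ p, p = extChartAt (𝓡 n) x₀ x₀ →
      (mfderiv (𝓡 n) (𝓡 n) (extChartAt (𝓡 n) x₀).symm p (X 0) : EuclideanSpace ℝ (Fin n))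
        = X 0 := by
    rintro _ rfl
    exact mfderiv_extChartAt_symm_self x₀ _
  exact (this _ hx0).trans hX

lemma isLinearlyParallelAt_extChartAt_symm (hx0 : x 0 = extChartAt (𝓡 n) x₀ x₀)
    (hc : ContinuousAt x 0)
    (hx : ∀ᶠ t in 𝓝 (0 : ℝ), ContDiffAt ℝ ∞ X t ∧
      deriv X t + connectionVec (localRep F x₀) (x t) (deriv x t) (X t) = 0) :
    IsLinearlyParallelAt F (fun t => (extChartAt (𝓡 n) x₀).symm (x t))
      (fun t => mfderiv (𝓡 n) (𝓡 n) (extChartAt (𝓡 n) x₀).symm (x t) (X t)) 0 := by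
  have h0 : (extChartAt (𝓡 n) x₀).symm (x 0) = x₀ := by rw [hx0]; simp
  have h1 := localCurve_extChartAt_symm hc hx0
  have h2 : localField x₀ (fun t => (extChartAt (𝓡 n) x₀).symm (x t))
      (fun t => mfderiv (𝓡 n) (𝓡 n) (extChartAt (𝓡 n) x₀).symm (x t) (X t)) =ᶠ[𝓝 0] X := by
    filter_upwards [eventually_mem_target_of_continuousAt hc hx0] with t ht
    exact mfderiv_extChartAt_mfderiv_symm ht (X t)
  unfold IsLinearlyParallelAt
  simp only [h0]
  constructor
  · filter_upwards [hx, h2.eventuallyEq_nhds] with t ht ht'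
    exact ht.1.congr_of_eventuallyEq ht'
  · filter_upwards [hx, h1, h1.deriv, h2, h2.deriv] with t ht h1 h1' h2 h2' i
    rw [h1, h1', h2, h2']
    exact congrArg (fun v : EuclideanSpace ℝ (Fin n) => v i) ht.2

end GeodesicChart

/-! ### The frame of the coset space given by a linear complement -/

section CosetFrame

variable {E : Type*} [NormedAddCommGroup E] [NormedSpace ℝ E]
  {G : Type*} [Group G] [TopologicalSpace G] [ChartedSpace E G]
  {H : Subgroup G} {n : ℕ} [ChartedSpace (EuclideanSpace ℝ (Fin n)) (G ⧸ H)]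
  {𝔪 : Submodule ℝ (GroupLieAlgebra 𝓘(ℝ, E) G)} {S : EuclideanSpace ℝ (Fin n) →L[ℝ] E}

variable (H) in
/-- The linear map `S` is inverse to the identification of `𝔪` with the tangent space at the
origin. -/
structure IsOriginSection (𝔪 : Submodule ℝ (GroupLieAlgebra 𝓘(ℝ, E) G))
    (S : EuclideanSpace ℝ (Fin n) →L[ℝ] E) : Prop where
  mem : ∀ v, (S v : GroupLieAlgebra 𝓘(ℝ, E) G) ∈ 𝔪
  apply_toTangentOrigin : ∀ v : 𝔪,
    S (toTangentOrigin (H := H) 𝔪 v) = (v : GroupLieAlgebra 𝓘(ℝ, E) G)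
  mfderiv_apply : ∀ v, (mfderiv 𝓘(ℝ, E) (𝓡 n) (cosetProj H) 1 (S v) : EuclideanSpace ℝ (Fin n)) = v

variable (H 𝔪) in
/-- The identification of `𝔪` with the tangent space at the origin as a linear map. -/
noncomputable def tangentOriginMap : 𝔪 →ₗ[ℝ] EuclideanSpace ℝ (Fin n) where
  toFun v := toTangentOrigin (H := H) 𝔪 v
  map_add' v w := map_add (mfderiv 𝓘(ℝ, E) (𝓡 n) (cosetProj H) 1)
    (v : GroupLieAlgebra 𝓘(ℝ, E) G) (w : GroupLieAlgebra 𝓘(ℝ, E) G)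
  map_smul' a v := map_smul (mfderiv 𝓘(ℝ, E) (𝓡 n) (cosetProj H) 1) a
    (v : GroupLieAlgebra 𝓘(ℝ, E) G)

variable (H S) in
/-- The frame of the coset space given by the images of left invariant fields: the coordinates of
the vector at `g • o` which is the image by `g` of a vector at the origin. -/
noncomputable def cosetFrame (ξ : E) :
    EuclideanSpace ℝ (Fin n) →L[ℝ] EuclideanSpace ℝ (Fin n) :=
  fderiv ℝ (cosetCoord H n) ξ ∘L (leftFrame G ξ ∘L S)

/-- The inverse of the identification of `𝔪` with the tangent space at the origin. -/
def IsOriginSection.lift (hS : IsOriginSection H 𝔪 S) (v : EuclideanSpace ℝ (Fin n)) : 𝔪 :=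
  ⟨S v, hS.mem v⟩

lemma IsOriginSection.tangentOriginMap_lift (hS : IsOriginSection H 𝔪 S)
    (v : EuclideanSpace ℝ (Fin n)) : tangentOriginMap H 𝔪 (hS.lift v) = v :=
  hS.mfderiv_apply v

lemma IsOriginSection.tangentOriginMap_injective (hS : IsOriginSection H 𝔪 S) :
    Function.Injective (tangentOriginMap H 𝔪 : 𝔪 → EuclideanSpace ℝ (Fin n)) := by
  intro v w h
  exact Subtype.ext ((hS.apply_toTangentOrigin v).symm.trans
    ((congrArg S h).trans (hS.apply_toTangentOrigin w)))

variable (H S) in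
/-- The derivative of the frame at the origin. -/
noncomputable def frameTorsion (v w : EuclideanSpace ℝ (Fin n)) : EuclideanSpace ℝ (Fin n) :=
  fderiv ℝ (cosetFrame H S) (chartOne E G) (S v) w

lemma frameTorsion_add_left (u v w : EuclideanSpace ℝ (Fin n)) :
    frameTorsion H S (u + v) w = frameTorsion H S u w + frameTorsion H S v w := by
  simp [frameTorsion]

lemma frameTorsion_add_right (u v w : EuclideanSpace ℝ (Fin n)) :
    frameTorsion H S u (v + w) = frameTorsion H S u v + frameTorsion H S u w := by
  simp [frameTorsion]

lemma frameTorsion_smul_left (a : ℝ) (v w : EuclideanSpace ℝ (Fin n)) :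
    frameTorsion H S (a • v) w = a • frameTorsion H S v w := by
  simp [frameTorsion]

lemma frameTorsion_smul_right (a : ℝ) (v w : EuclideanSpace ℝ (Fin n)) :
    frameTorsion H S v (a • w) = a • frameTorsion H S v w := by
  simp [frameTorsion]

variable [LieGroup 𝓘(ℝ, E) ∞ G]

lemma contDiffOn_leftFrame_comp :
    ContDiffOn ℝ ∞ (fun ξ => leftFrame G ξ ∘L S) (cosetDomain E H n) :=
  ((contDiffOn_leftFrame (G := G)).mono Set.inter_subset_left).clm_comp contDiffOn_const

/-- The map `π_*` is onto with kernel `𝔥`, so it restricts to an isomorphism on any complement `𝔪`.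
-/
lemma exists_isOriginSection [FiniteDimensional ℝ E]
    (hπ : Manifold.IsSubmersion 𝓘(ℝ, E) (𝓡 n) ∞ (cosetProj H))
    (h𝔪 : IsCompl 𝔪 (subgroupLieAlgebra H)) :
    ∃ S : EuclideanSpace ℝ (Fin n) →L[ℝ] E, IsOriginSection H 𝔪 S := by
  have hd : MDifferentiableAt 𝓘(ℝ, E) (𝓡 n) (cosetProj H) 1 :=
    (hπ.contMDiff 1).mdifferentiableAt (by simp)
  have hinj : Function.Injective (tangentOriginMap H 𝔪 : 𝔪 → EuclideanSpace ℝ (Fin n)) := by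
    rw [← LinearMap.ker_eq_bot, LinearMap.ker_eq_bot']
    intro v hv
    have h1 : (v : GroupLieAlgebra 𝓘(ℝ, E) G) ∈ subgroupLieAlgebra H :=
      (mem_subgroupLieAlgebra_iff hπ.contMDiff (hπ.isSubmersionAt 1) _).2 hv
    exact Subtype.ext (Submodule.disjoint_def.1 h𝔪.disjoint _ v.2 h1)
  have hsurj : Function.Surjective (tangentOriginMap H 𝔪 : 𝔪 → EuclideanSpace ℝ (Fin n)) := by
    intro u
    obtain ⟨v, hv⟩ := (hπ.isSubmersionAt 1).mfderiv_surjective hd u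
    obtain ⟨a, ha, b, hb, hab⟩ := Submodule.mem_sup.1
      (h𝔪.codisjoint.eq_top ▸ Submodule.mem_top : v ∈ 𝔪 ⊔ subgroupLieAlgebra H)
    have h1 := (mem_subgroupLieAlgebra_iff hπ.contMDiff (hπ.isSubmersionAt 1) b).1 hb
    refine ⟨⟨a, ha⟩, ?_⟩
    have h2 : ∀ T : E →L[ℝ] EuclideanSpace ℝ (Fin n), ∀ a b v : E, a + b = v → T b = 0 → T v = u →
      T a = u := by
      rintro T a b v rfl hb hv
      simpa [hb] using hv
    exact h2 _ a b v hab h1 hv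
  let e := LinearEquiv.ofBijective (tangentOriginMap H 𝔪) ⟨hinj, hsurj⟩
  let L : EuclideanSpace ℝ (Fin n) →ₗ[ℝ] E := 𝔪.subtype ∘ₗ e.symm.toLinearMap
  refine ⟨LinearMap.toContinuousLinearMap L, ⟨fun v => (e.symm v).2, fun v => ?_, fun v => ?_⟩⟩
  · exact congrArg Subtype.val (e.symm_apply_apply v)
  · exact e.apply_symm_apply v

variable [IsManifold (𝓡 n) ∞ (G ⧸ H)]

lemma IsOriginSection.cosetFrame_chartOne (hS : IsOriginSection H 𝔪 S)
    (hπ : ContMDiff 𝓘(ℝ, E) (𝓡 n) ∞ (cosetProj H)) :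
    cosetFrame H S (chartOne E G) = ContinuousLinearMap.id ℝ _ := by
  rw [cosetFrame, leftFrame_chartOne]
  ext1 v
  exact (mfderiv_cosetProj_one hπ (S v)).symm.trans (hS.mfderiv_apply v)

lemma contDiffOn_cosetFrame (hπ : ContMDiff 𝓘(ℝ, E) (𝓡 n) ∞ (cosetProj H)) :
    ContDiffOn ℝ ∞ (cosetFrame H S) (cosetDomain E H n) :=
  ((contDiffOn_cosetCoord hπ).fderiv_of_isOpen (isOpen_cosetDomain hπ) (by simp)).clm_comp
    contDiffOn_leftFrame_comp

lemma differentiableAt_cosetFrame (hπ : ContMDiff 𝓘(ℝ, E) (𝓡 n) ∞ (cosetProj H)) :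
    DifferentiableAt ℝ (cosetFrame H S) (chartOne E G) :=
  ((contDiffOn_cosetFrame hπ).contDiffAt ((isOpen_cosetDomain hπ).mem_nhds
    chartOne_mem_cosetDomain)).differentiableAt (by simp)

/-- Product rule for the frame. The Hessian term is symmetric in `v` and `w`; the other carries the
derivative of the left invariant fields, hence the bracket. -/
lemma frameTorsion_eq (hπ : ContMDiff 𝓘(ℝ, E) (𝓡 n) ∞ (cosetProj H))
    (v w : EuclideanSpace ℝ (Fin n)) :
    frameTorsion H S v w = fderiv ℝ (fderiv ℝ (cosetCoord H n)) (chartOne E G) (S v) (S w)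
      + fderiv ℝ (cosetCoord H n) (chartOne E G)
        (fderiv ℝ (fun ξ => leftFrame G ξ (S w)) (chartOne E G) (S v)) := by
  have h1 := (((contDiffOn_cosetCoord hπ).fderiv_of_isOpen (m := ∞) (isOpen_cosetDomain hπ)
    (by simp)).contDiffAt ((isOpen_cosetDomain hπ).mem_nhds
    chartOne_mem_cosetDomain)).differentiableAt (by simp)
  have h2 : DifferentiableAt ℝ (leftFrame G) (chartOne E G) :=
    ((contDiffOn_leftFrame (G := G)).contDiffAt ((isOpen_extChartAt_target _).mem_nhds
      chartOne_mem_target)).differentiableAt (by simp)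
  have h3 := (differentiableAt_cosetFrame (S := S) hπ).hasFDerivAt.clm_apply (hasFDerivAt_const w _)
  have h4 := h1.hasFDerivAt.clm_apply (h2.hasFDerivAt.clm_apply (hasFDerivAt_const (S w) _))
  have h5 := (h2.hasFDerivAt.clm_apply (hasFDerivAt_const (S w) _)).fderiv
  have h6 := congrArg (fun T : E →L[ℝ] EuclideanSpace ℝ (Fin n) => T (S v)) (h3.unique h4)
  rw [h5, frameTorsion]
  simpa [leftFrame_chartOne, add_comm] using h6

/-- The `𝔥`-component dropped by the projection is annihilated by `π_*`. -/
lemma tangentOriginMap_projectionOnto (hπ : ContMDiff 𝓘(ℝ, E) (𝓡 n) ∞ (cosetProj H))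
    (hs : Manifold.IsSubmersionAt 𝓘(ℝ, E) (𝓡 n) ∞ (cosetProj H) 1)
    (h𝔪 : IsCompl 𝔪 (subgroupLieAlgebra H)) (z : GroupLieAlgebra 𝓘(ℝ, E) G) :
    tangentOriginMap H 𝔪 (𝔪.projectionOnto (subgroupLieAlgebra H) h𝔪 z)
      = fderiv ℝ (cosetCoord H n) (chartOne E G) z := by
  have h1 : z - (𝔪.projectionOnto (subgroupLieAlgebra H) h𝔪 z : GroupLieAlgebra 𝓘(ℝ, E) G)
      ∈ subgroupLieAlgebra H := by
    rw [← Submodule.projectionOnto_apply_eq_zero_iff h𝔪, map_sub,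
      Submodule.projectionOnto_apply_left, sub_self]
  have h2 := (mem_subgroupLieAlgebra_iff hπ hs _).1 h1
  have h3 : ∀ T : E →L[ℝ] EuclideanSpace ℝ (Fin n), ∀ a b : E, T (a - b) = 0 → T b = T a := by
    intro T a b h
    rw [map_sub, sub_eq_zero] at h
    exact h.symm
  exact (h3 _ _ _ h2).trans (mfderiv_cosetProj_one hπ z)

/-- Antisymmetrizing `frameTorsion_eq` cancels the Hessian and leaves `df` of the coordinate
bracket. No `Ad(H)`-invariance of `𝔪` enters. -/
lemma IsOriginSection.tangentOriginMap_bracketProj [CompleteSpace E] (hS : IsOriginSection H 𝔪 S)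
    (hπ : ContMDiff 𝓘(ℝ, E) (𝓡 n) ∞ (cosetProj H))
    (hs : Manifold.IsSubmersionAt 𝓘(ℝ, E) (𝓡 n) ∞ (cosetProj H) 1)
    (h𝔪 : IsCompl 𝔪 (subgroupLieAlgebra H)) (v w : 𝔪) :
    tangentOriginMap H 𝔪 (bracketProj h𝔪 v w)
      = frameTorsion H S (tangentOriginMap H 𝔪 v) (tangentOriginMap H 𝔪 w)
        - frameTorsion H S (tangentOriginMap H 𝔪 w) (tangentOriginMap H 𝔪 v) := by
  have h1 := groupLieAlgebra_bracket_eq (v : GroupLieAlgebra 𝓘(ℝ, E) G)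
    (w : GroupLieAlgebra 𝓘(ℝ, E) G) (hS.apply_toTangentOrigin v) (hS.apply_toTangentOrigin w)
  have h2 : ∀ a b, fderiv ℝ (fderiv ℝ (cosetCoord H n)) (chartOne E G) a b
      = fderiv ℝ (fderiv ℝ (cosetCoord H n)) (chartOne E G) b a := by
    have h := ((contDiffOn_cosetCoord hπ).contDiffAt ((isOpen_cosetDomain hπ).mem_nhds
      chartOne_mem_cosetDomain)).isSymmSndFDerivAt
        (by
      simp only [minSmoothness_of_isRCLikeNormedField]
      exact WithTop.coe_le_coe.2 (le_top : (2 : ℕ∞) ≤ ⊤))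
    exact fun a b => h a b
  refine (tangentOriginMap_projectionOnto hπ hs h𝔪 _).trans ?_
  refine (congrArg (fderiv ℝ (cosetCoord H n) (chartOne E G)) h1).trans ?_
  rw [frameTorsion_eq hπ, frameTorsion_eq hπ, h2]
  refine (map_sub (fderiv ℝ (cosetCoord H n) (chartOne E G)) _ _).trans ?_
  rw [add_sub_add_left_eq_sub]
  rfl

end CosetFrame

/-! ### The spray vector field -/

lemma Submodule.hasDerivAt_comp_iff {E V : Type*} [NormedAddCommGroup E] [NormedSpace ℝ E]
    [FiniteDimensional ℝ E] [NormedAddCommGroup V] [NormedSpace ℝ V] [FiniteDimensional ℝ V]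
    (p : Submodule ℝ E) (T : p →ₗ[ℝ] V) (hT : Function.Injective T) {f : ℝ → p} {d : p} {t : ℝ} :
    HasDerivAt (fun s => T (f s)) (T d) t ↔ HasDerivAt f d t := by
  constructor
  · intro h
    obtain ⟨g, hg⟩ := T.exists_leftInverse_of_injective (LinearMap.ker_eq_bot.2 hT)
    have h1 : ∀ v, g (T v) = v := fun v => LinearMap.congr_fun hg v
    have h2 := (LinearMap.toContinuousLinearMap g).hasFDerivAt.comp_hasDerivAt t h
    simpa only [Function.comp_def, LinearMap.coe_toContinuousLinearMap', h1] using h2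
  · exact fun h => (LinearMap.toContinuousLinearMap T).hasFDerivAt.comp_hasDerivAt t h

lemma Submodule.deriv_eq_of_hasDerivAt_comp {E V : Type*} [NormedAddCommGroup E] [NormedSpace ℝ E]
    [FiniteDimensional ℝ E] [NormedAddCommGroup V] [NormedSpace ℝ V] [FiniteDimensional ℝ V]
    (p : Submodule ℝ E) (T : p →ₗ[ℝ] V) (hT : Function.Injective T) {f : ℝ → p} {d : p} {t : ℝ}
    (h : HasDerivAt (fun s => T (f s)) (T d) t) : deriv f t = d :=
  ((p.hasDerivAt_comp_iff T hT).1 h).deriv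

lemma ContDiffAt.differentiableAt_deriv {V : Type*} [NormedAddCommGroup V] [NormedSpace ℝ V]
    {x : ℝ → V} {t : ℝ} (hx : ContDiffAt ℝ ∞ x t) : DifferentiableAt ℝ (deriv x) t := by
  have h1 : ContDiffAt ℝ ∞ (fderiv ℝ x) t := hx.fderiv_right (by simp)
  have h2 := (h1.clm_apply (contDiffAt_const (c := (1 : ℝ)))).differentiableAt (by simp)
  simpa only [fderiv_apply_one_eq_deriv] using h2

section SprayField

variable {E : Type*} [NormedAddCommGroup E] [NormedSpace ℝ E] [FiniteDimensional ℝ E]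
  {G : Type*} [Group G] [TopologicalSpace G] [ChartedSpace E G] [LieGroup 𝓘(ℝ, E) ∞ G]
  {H : Subgroup G} {n : ℕ} [ChartedSpace (EuclideanSpace ℝ (Fin n)) (G ⧸ H)]
  [IsManifold (𝓡 n) ∞ (G ⧸ H)] {F : TangentBundle (𝓡 n) (G ⧸ H) → ℝ}
  {𝔪 : Submodule ℝ (GroupLieAlgebra 𝓘(ℝ, E) G)} {S : EuclideanSpace ℝ (Fin n) →L[ℝ] E}

/-- Projecting the lift gives `ẋ = A(ξ) y(t)` with `ξ'(0) = S y`. Differentiating at 0, `ẍ = B(y, y)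
- e`, while `ẍ = -2 G(y)`. The value does not depend on the chosen geodesic and lift. -/
lemma IsOriginSection.tangentOriginMap_of_isSprayVector (hS : IsOriginSection H 𝔪 S)
    (hπ : ContMDiff 𝓘(ℝ, E) (𝓡 n) ∞ (cosetProj H)) {y e : 𝔪} (h : IsSprayVector F 𝔪 y e) :
    tangentOriginMap H 𝔪 e
      = (2 : ℝ) • sprayVec (localRep F (cosetOrigin H))
          (extChartAt (𝓡 n) (cosetOrigin H) (cosetOrigin H)) (tangentOriginMap H 𝔪 y)
        + frameTorsion H S (tangentOriginMap H 𝔪 y) (tangentOriginMap H 𝔪 y) := by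
  obtain ⟨c, c', yt, hc, hcy, ⟨hc', hc'0, hcc', hyt⟩, hd⟩ := h
  have h0 := (tangentBundle_mk_eq_iff.1 hcy).1
  have hcv : deriv (localCurve (n := n) (cosetOrigin H) c) 0 = tangentOriginMap H 𝔪 y :=
    deriv_localCurve_zero (hc.1.self_of_nhds.mdifferentiableAt (by simp)) hcy
  have hloc := hc.eventually_localCurve h0
  have hψ0 : extChartAt 𝓘(ℝ, E) (1 : G) (c' 0) = chartOne E G := by rw [hc'0, chartOne]
  have hTd : HasDerivAt (fun t => tangentOriginMap H 𝔪 (yt t)) (tangentOriginMap H 𝔪 (-e)) 0 :=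
    (Submodule.hasDerivAt_comp_iff (E := E) 𝔪 (tangentOriginMap H 𝔪)
      hS.tangentOriginMap_injective).2 hd
  have hev : ∀ᶠ t in 𝓝 (0 : ℝ),
      HasDerivAt (fun s => extChartAt 𝓘(ℝ, E) (1 : G) (c' s))
        (leftFrame G (extChartAt 𝓘(ℝ, E) (1 : G) (c' t)) (S (tangentOriginMap H 𝔪 (yt t)))) t ∧
      deriv (localCurve (n := n) (cosetOrigin H) c) t
        = cosetFrame H S (extChartAt 𝓘(ℝ, E) (1 : G) (c' t)) (tangentOriginMap H 𝔪 (yt t)) := by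
    have h1 : ∀ᶠ t in 𝓝 (0 : ℝ), c' t ∈ (extChartAt 𝓘(ℝ, E) (1 : G)).source :=
      hc'.self_of_nhds.continuousAt.eventually_mem
        (by rw [hc'0]; exact extChartAt_source_mem_nhds (1 : G))
    filter_upwards [h1, hc', hcc'.eventually_nhds, hyt, hloc] with t h1 h2 h3 h4 h5
    have hlift : S (tangentOriginMap H 𝔪 (yt t)) = (yt t : GroupLieAlgebra 𝓘(ℝ, E) G) :=
      hS.apply_toTangentOrigin (yt t)
    have h6 : HasDerivAt (fun s => extChartAt 𝓘(ℝ, E) (1 : G) (c' s))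
        (leftFrame G (extChartAt 𝓘(ℝ, E) (1 : G) (c' t)) (S (tangentOriginMap H 𝔪 (yt t)))) t := by
      refine deriv_extChartAt_comp (h2.mdifferentiableAt (by simp)) h1 ?_
      rw [h4, hlift]
      exact mfderiv_extChartAt_mulInvariantVectorField h1 _
    refine ⟨h6, ?_⟩
    have h7 : extChartAt 𝓘(ℝ, E) (1 : G) (c' t) ∈ cosetDomain E H n := by
      refine ⟨(extChartAt 𝓘(ℝ, E) (1 : G)).map_source h1, ?_⟩
      rw [Set.mem_preimage, Set.mem_preimage, (extChartAt 𝓘(ℝ, E) (1 : G)).left_inv h1,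
        ← h3.self_of_nhds]
      exact h5.1
    have h8 := (((contDiffOn_cosetCoord hπ).contDiffAt
      ((isOpen_cosetDomain hπ).mem_nhds h7)).differentiableAt
        (by simp)).hasFDerivAt.comp_hasDerivAt t h6
    refine (h8.congr_of_eventuallyEq ?_).deriv
    filter_upwards [h3, h2.continuousAt.eventually_mem
      ((isOpen_extChartAt_source (I := 𝓘(ℝ, E)) (1 : G)).mem_nhds h1)] with s h3 h1
    rw [Function.comp, cosetCoord, (extChartAt 𝓘(ℝ, E) (1 : G)).left_inv h1, ← h3]
    rfl
  have h9 : deriv (localCurve (n := n) (cosetOrigin H) c) 0 = tangentOriginMap H 𝔪 (yt 0) := by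
    rw [hev.self_of_nhds.2, hψ0, hS.cosetFrame_chartOne hπ]
    rfl
  have h10 := hev.self_of_nhds.1
  rw [hψ0, leftFrame_chartOne, ContinuousLinearMap.id_apply] at h10
  have h11 := hasDerivAt_frame_apply (differentiableAt_cosetFrame (S := S) hπ)
    (hS.cosetFrame_chartOne hπ) h10 hψ0 hTd
  have h12 : deriv (localCurve (n := n) (cosetOrigin H) c) =ᶠ[𝓝 0] fun t =>
      cosetFrame H S (extChartAt 𝓘(ℝ, E) (1 : G) (c' t)) (tangentOriginMap H 𝔪 (yt t)) :=
    hev.mono fun t ht => ht.2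
  have h13 := (h11.congr_of_eventuallyEq h12).deriv
  have h14 := hloc.self_of_nhds.2.2.2
  have h15 : localCurve (n := n) (cosetOrigin H) c 0
      = extChartAt (𝓡 n) (cosetOrigin H) (cosetOrigin H) := by rw [localCurve, h0]
  rw [h13, ← h9, hcv, h15, map_neg] at h14
  rw [frameTorsion]
  have h16 : ∀ a b c : EuclideanSpace ℝ (Fin n), a + -b + (2 : ℝ) • c = 0 →
      b = (2 : ℝ) • c + a := by
    intro a b c h
    rw [← sub_eq_zero, ← neg_eq_zero, ← h]
    abel
  exact h16 _ _ _ h14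

/-- The lift solves the joint ODE with `Ψ = leftFrame ∘ S`, which forces `y(t) = S(A⁻¹ ẋ) ∈ 𝔪`. This
is differentiable because the inverse frame and `ẋ` are. -/
lemma IsOriginSection.exists_isSprayVector (hS : IsOriginSection H 𝔪 S)
    (hπ : ContMDiff 𝓘(ℝ, E) (𝓡 n) ∞ (cosetProj H)) (hF : IsFinslerMetric F) {y : 𝔪}
    (hy : y ≠ 0) : ∃ e, IsSprayVector F 𝔪 y e := by
  have hy' : (tangentOriginMap H 𝔪 y : EuclideanSpace ℝ (Fin n)) ≠ 0 := fun h =>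
    hy (hS.tangentOriginMap_injective (h.trans (map_zero _).symm))
  -- The parallel field plays no role here, so its initial value is taken to be 0.
  obtain ⟨x, X, ξ, hx0, hxy, -, hξ0, hev⟩ := (hF.isLocalFinsler (cosetOrigin H)).exists_geodesic
    (isOpen_cosetDomain hπ) (contDiffOn_cosetCoord hπ) (contDiffOn_leftFrame_comp (S := S))
    chartOne_mem_cosetDomain
    (by rw [cosetCoord_chartOne]; exact mem_extChartAt_target _)
    (hS.cosetFrame_chartOne hπ) hy' 0
  rw [cosetCoord_chartOne] at hx0
  have hcont : ContDiffAt ℝ ∞ x 0 := hev.self_of_nhds.2.2.1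
  have hx' : HasDerivAt x (tangentOriginMap H 𝔪 y) 0 :=
    hxy ▸ (hcont.differentiableAt (by simp)).hasDerivAt
  have hx'' : HasDerivAt (deriv x) (deriv (deriv x) 0) 0 :=
    (ContDiffAt.differentiableAt_deriv hcont).hasDerivAt
  have hξ' : HasDerivAt ξ (S (tangentOriginMap H 𝔪 y)) 0 := by
    have h1 := hev.self_of_nhds.2.2.2.2.2.2.2.2.2
    change HasDerivAt ξ ((leftFrame G (ξ 0) ∘L S) ((cosetFrame H S (ξ 0)).inverse (deriv x 0))) 0
      at h1
    rw [hξ0, hS.cosetFrame_chartOne hπ, leftFrame_chartOne, hxy] at h1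
    simpa using h1
  have hu := hasDerivAt_frame_inverse (differentiableAt_cosetFrame (S := S) hπ)
    (hS.cosetFrame_chartOne hπ) hξ' hξ0 hx''
  obtain ⟨e', he'⟩ : ∃ e', HasDerivAt (fun t => tangentOriginMap H 𝔪
      (hS.lift ((cosetFrame H S (ξ t)).inverse (deriv x t)))) (tangentOriginMap H 𝔪 e') 0 := by
    refine ⟨hS.lift (deriv (deriv x) 0 - frameTorsion H S (tangentOriginMap H 𝔪 y) (deriv x 0)),
      ?_⟩
    exact (hu.congr_of_eventuallyEq (.of_forall fun t => hS.tangentOriginMap_lift _)).congr_deriv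
      (hS.tangentOriginMap_lift _).symm
  refine ⟨-e', fun t => (extChartAt (𝓡 n) (cosetOrigin H)).symm (x t),
    fun t => (extChartAt 𝓘(ℝ, E) (1 : G)).symm (ξ t),
    fun t => hS.lift ((cosetFrame H S (ξ t)).inverse (deriv x t)), ?_, ?_, ?_, ?_⟩
  · refine isGeodesicAt_extChartAt_symm hx0 (hev.mono fun t ht => ⟨ht.2.2.1, ht.2.2.2.2.2.1,
      ht.2.2.2.2.2.2.1⟩)
  · exact curveVelocity_extChartAt_symm_zero hx0 hx'
  · refine ⟨?_, (congrArg _ hξ0).trans extChartAt_symm_chartOne, ?_, ?_⟩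
    · filter_upwards [hev] with t ht
      exact (contMDiffAt_extChartAt_symm ht.2.1.1).comp t ht.2.2.2.2.1.contMDiffAt
    · filter_upwards [hev] with t ht
      rw [← ht.2.2.2.2.2.2.2.2.1, cosetCoord]
      exact (extChartAt (𝓡 n) (cosetOrigin H)).left_inv ht.2.1.2
    · filter_upwards [hev] with t ht
      have hs := (extChartAt 𝓘(ℝ, E) (1 : G)).map_target ht.2.1.1
      refine mfderiv_extChartAt_injective hs ?_
      rw [mfderiv_extChartAt_mulInvariantVectorField hs,
        (extChartAt 𝓘(ℝ, E) (1 : G)).right_inv ht.2.1.1]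
      refine (congrArg _ (mfderiv_extChartAt_symm_comp ht.2.2.2.2.2.2.2.2.2 ht.2.1.1)).trans ?_
      exact mfderiv_extChartAt_mfderiv_symm ht.2.1.1 _
  · rw [neg_neg]
    exact (Submodule.hasDerivAt_comp_iff (E := E) 𝔪 (tangentOriginMap H 𝔪)
      hS.tangentOriginMap_injective).1 he'

lemma IsOriginSection.tangentOriginMap_sprayVectorField (hS : IsOriginSection H 𝔪 S)
    (hπ : ContMDiff 𝓘(ℝ, E) (𝓡 n) ∞ (cosetProj H)) (hF : IsFinslerMetric F) {y : 𝔪}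
    (hy : y ≠ 0) :
    tangentOriginMap H 𝔪 (sprayVectorField F 𝔪 y)
      = (2 : ℝ) • sprayVec (localRep F (cosetOrigin H))
          (extChartAt (𝓡 n) (cosetOrigin H) (cosetOrigin H)) (tangentOriginMap H 𝔪 y)
        + frameTorsion H S (tangentOriginMap H 𝔪 y) (tangentOriginMap H 𝔪 y) :=
  hS.tangentOriginMap_of_isSprayVector hπ
    (Classical.epsilon_spec (hS.exists_isSprayVector hπ hF hy))

/-- Half the derivative of `2 G(y) + B(y, y)` is `N_coord(w) + ½(B(w, y) + B(y, w))`. Subtracting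
`½[y, w]_𝔪 = ½(B(y, w) - B(w, y))` leaves one torsion term. -/
lemma IsOriginSection.tangentOriginMap_connectionOperator (hS : IsOriginSection H 𝔪 S)
    (hπ : ContMDiff 𝓘(ℝ, E) (𝓡 n) ∞ (cosetProj H))
    (hs : Manifold.IsSubmersionAt 𝓘(ℝ, E) (𝓡 n) ∞ (cosetProj H) 1) (hF : IsFinslerMetric F)
    (h𝔪 : IsCompl 𝔪 (subgroupLieAlgebra H)) {y : 𝔪} (hy : y ≠ 0) (w : 𝔪) :
    tangentOriginMap H 𝔪 (connectionOperator F h𝔪 y w)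
      = connectionVec (localRep F (cosetOrigin H))
          (extChartAt (𝓡 n) (cosetOrigin H) (cosetOrigin H)) (tangentOriginMap H 𝔪 y)
          (tangentOriginMap H 𝔪 w)
        + frameTorsion H S (tangentOriginMap H 𝔪 w) (tangentOriginMap H 𝔪 y) := by
  have hy' : (tangentOriginMap H 𝔪 y : EuclideanSpace ℝ (Fin n)) ≠ 0 := fun h =>
    hy (hS.tangentOriginMap_injective (h.trans (map_zero _).symm))
  generalize hv : (tangentOriginMap H 𝔪 y : EuclideanSpace ℝ (Fin n)) = v at *
  generalize hu : (tangentOriginMap H 𝔪 w : EuclideanSpace ℝ (Fin n)) = u at *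
  have h1 := (hF.isLocalFinsler (cosetOrigin H)).hasDerivAt_sprayVec
    (mem_extChartAt_target (cosetOrigin H)) hy' u
  have h2 : HasDerivAt (fun t : ℝ => frameTorsion H S (v + t • u) (v + t • u))
      (frameTorsion H S u v + frameTorsion H S v u) 0 := by
    have h : ∀ t : ℝ, frameTorsion H S (v + t • u) (v + t • u) = frameTorsion H S v v
        + t • (frameTorsion H S u v + frameTorsion H S v u) + t ^ 2 • frameTorsion H S u u := by
      intro t
      simp only [frameTorsion_add_left, frameTorsion_add_right, frameTorsion_smul_left,
        frameTorsion_smul_right]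
      module
    simp only [h]
    have h3 := (((hasDerivAt_id (0 : ℝ)).smul_const
      (frameTorsion H S u v + frameTorsion H S v u)).const_add (frameTorsion H S v v)).add
      (((hasDerivAt_id (0 : ℝ)).pow 2).smul_const (frameTorsion H S u u))
    exact h3.congr_deriv (by simp)
  -- The formula for `η` holds off 0 only, so it can be differentiated because the line avoids 0 for
  -- small `t`.
  have h3 : ∀ᶠ t : ℝ in 𝓝 0, v + t • u ≠ 0 := by
    have : ContinuousAt (fun t : ℝ => v + t • u) 0 := by fun_prop
    exact this.eventually_ne (by simpa using hy')
  have h4 : HasDerivAt (F := EuclideanSpace ℝ (Fin n))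
      (fun t : ℝ => tangentOriginMap H 𝔪 (sprayVectorField F 𝔪 (y + t • w)))
      (tangentOriginMap H 𝔪 (hS.lift ((2 : ℝ) • connectionVec (localRep F (cosetOrigin H))
          (extChartAt (𝓡 n) (cosetOrigin H) (cosetOrigin H)) v u
        + (frameTorsion H S u v + frameTorsion H S v u)))) 0 := by
    refine (((h1.const_smul (2 : ℝ)).add h2).congr_of_eventuallyEq ?_).congr_deriv
      (hS.tangentOriginMap_lift _).symm
    filter_upwards [h3] with t ht
    have h5 : tangentOriginMap H 𝔪 (y + t • w) = v + t • u := by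
      rw [map_add, map_smul, hv, hu]
    have h6 : y + t • w ≠ 0 := fun h => ht (by rw [← h5, h, map_zero])
    rw [hS.tangentOriginMap_sprayVectorField hπ hF h6, h5]
    rfl
  have h5 := Submodule.deriv_eq_of_hasDerivAt_comp (E := E) 𝔪 (tangentOriginMap H 𝔪)
    hS.tangentOriginMap_injective h4
  have h6 : connectionOperator F h𝔪 y w = (1 / 2 : ℝ) • hS.lift ((2 : ℝ) •
      connectionVec (localRep F (cosetOrigin H))
          (extChartAt (𝓡 n) (cosetOrigin H) (cosetOrigin H)) v u
        + (frameTorsion H S u v + frameTorsion H S v u)) - (1 / 2 : ℝ) • bracketProj h𝔪 y w :=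
    congrArg (fun z => (1 / 2 : ℝ) • z - (1 / 2 : ℝ) • bracketProj h𝔪 y w) h5
  rw [h6, map_sub, map_smul, map_smul, hS.tangentOriginMap_lift,
    hS.tangentOriginMap_bracketProj hπ hs, hu, hv]
  module

end SprayField

/-! ### The Landsberg curvature -/

section Landsberg

variable {E : Type*} [NormedAddCommGroup E] [NormedSpace ℝ E]
  {G : Type*} [Group G] [TopologicalSpace G] [ChartedSpace E G] [LieGroup 𝓘(ℝ, E) ∞ G]
  {H : Subgroup G} {n : ℕ} [ChartedSpace (EuclideanSpace ℝ (Fin n)) (G ⧸ H)]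
  [IsManifold (𝓡 n) ∞ (G ⧸ H)] {F : TangentBundle (𝓡 n) (G ⧸ H) → ℝ}
  {𝔪 : Submodule ℝ (GroupLieAlgebra 𝓘(ℝ, E) G)} {S : EuclideanSpace ℝ (Fin n) →L[ℝ] E}

/-- Inverse function theorem for `v ↦ f(e + S v)`, whose derivative at 0 is the identity. The
Landsberg derivative needs a lift of the geodesic with initial velocity `S y` only, not a horizontal
one, so composing with this section suffices for any given geodesic. -/
lemma IsOriginSection.exists_localSection (hS : IsOriginSection H 𝔪 S)
    (hπ : ContMDiff 𝓘(ℝ, E) (𝓡 n) ∞ (cosetProj H)) :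
    ∃ σ : EuclideanSpace ℝ (Fin n) → E,
      σ (extChartAt (𝓡 n) (cosetOrigin H) (cosetOrigin H)) = chartOne E G ∧
      HasFDerivAt σ S (extChartAt (𝓡 n) (cosetOrigin H) (cosetOrigin H)) ∧
      ∀ᶠ x in 𝓝 (extChartAt (𝓡 n) (cosetOrigin H) (cosetOrigin H)),
        cosetCoord H n (σ x) = x := by
  have h1 : HasStrictFDerivAt (cosetCoord H n) (fderiv ℝ (cosetCoord H n) (chartOne E G))
      (chartOne E G + S 0) := by
    rw [map_zero, add_zero]
    exact ((contDiffOn_cosetCoord hπ).contDiffAt ((isOpen_cosetDomain hπ).mem_nhds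
      chartOne_mem_cosetDomain)).hasStrictFDerivAt (by simp)
  have h2 : HasStrictFDerivAt (fun v => cosetCoord H n (chartOne E G + S v))
      ((ContinuousLinearEquiv.refl ℝ (EuclideanSpace ℝ (Fin n)) :
        EuclideanSpace ℝ (Fin n) →L[ℝ] EuclideanSpace ℝ (Fin n))) 0 := by
    refine (h1.comp (0 : EuclideanSpace ℝ (Fin n))
      (S.hasStrictFDerivAt.const_add (chartOne E G))).congr_fderiv ?_
    ext1 v
    exact (mfderiv_cosetProj_one hπ (S v)).symm.trans (hS.mfderiv_apply v)
  have h3 := h2.to_localInverse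
  have h4 := h2.eventually_right_inverse
  have h5 := h2.localInverse_apply_image
  generalize h2.localInverse _ _ _ = τ at h3 h4 h5
  simp only [map_zero, add_zero, cosetCoord_chartOne] at h3 h4 h5
  refine ⟨fun x => chartOne E G + S (τ x), by simp only [h5, map_zero, add_zero], ?_, h4⟩
  exact ((S.hasFDerivAt.comp _ h3.hasFDerivAt).const_add (chartOne E G))

/-- Translation by `g` is a linear map `T_o → T_{g • o}` carrying `F(o, ·)` to `F(g • o, ·)`, and
the frame is its coordinate form. Naturality of the Cartan tensor gives the rest. -/
lemma IsOriginSection.cartanTensor_fiberNorm_eq (hS : IsOriginSection H 𝔪 S)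
    (hπ : ContMDiff 𝓘(ℝ, E) (𝓡 n) ∞ (cosetProj H))
    (hs : Manifold.IsSubmersionAt 𝓘(ℝ, E) (𝓡 n) ∞ (cosetProj H) 1) (hinv : IsInvariantMetric F)
    {p : G ⧸ H} {ξ : E} (hξ : ξ ∈ cosetDomain E H n)
    (hp : cosetProj H ((extChartAt 𝓘(ℝ, E) (1 : G)).symm ξ) = p)
    {Y U V W : TangentSpace (𝓡 n) p} {u a b d : EuclideanSpace ℝ (Fin n)}
    (hY : mfderiv (𝓡 n) (𝓡 n) (extChartAt (𝓡 n) (cosetOrigin H)) p Y = cosetFrame H S ξ u)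
    (hU : mfderiv (𝓡 n) (𝓡 n) (extChartAt (𝓡 n) (cosetOrigin H)) p U = cosetFrame H S ξ a)
    (hV : mfderiv (𝓡 n) (𝓡 n) (extChartAt (𝓡 n) (cosetOrigin H)) p V = cosetFrame H S ξ b)
    (hW : mfderiv (𝓡 n) (𝓡 n) (extChartAt (𝓡 n) (cosetOrigin H)) p W = cosetFrame H S ξ d) :
    cartanTensor (fiberNorm F p) Y U V W
      = cartanTensor (localRep F (cosetOrigin H)
          (extChartAt (𝓡 n) (cosetOrigin H) (cosetOrigin H))) u a b d := by
  subst hp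
  obtain ⟨hξ1, hξ2⟩ := hξ
  have hg := (extChartAt 𝓘(ℝ, E) (1 : G)).map_target hξ1
  have hr := (extChartAt 𝓘(ℝ, E) (1 : G)).right_inv hξ1
  rw [Set.mem_preimage, Set.mem_preimage] at hξ2
  generalize (extChartAt 𝓘(ℝ, E) (1 : G)).symm ξ = g at *
  let τ : EuclideanSpace ℝ (Fin n) →ₗ[ℝ] TangentSpace (𝓡 n) (cosetProj H g) :=
    (mfderiv (𝓡 n) (𝓡 n) (fun x : G ⧸ H => g • x) (cosetOrigin H) :
      EuclideanSpace ℝ (Fin n) →L[ℝ] EuclideanSpace ℝ (Fin n)).toLinearMap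
  have hτ : ∀ v, mfderiv (𝓡 n) (𝓡 n) (extChartAt (𝓡 n) (cosetOrigin H)) (cosetProj H g) (τ v)
      = cosetFrame H S ξ v := by
    intro v
    have h1 := mfderiv_cosetProj_mulInvariantVectorField hπ hg hξ2 (S v)
    rw [hr] at h1
    have h2 := mfderiv_smul_mfderiv_cosetProj hπ hs g (S v)
    have h3 : τ v = mfderiv 𝓘(ℝ, E) (𝓡 n) (cosetProj H) g (mulInvariantVectorField (S v) g) :=
      (congrArg τ (hS.mfderiv_apply v)).symm.trans h2
    rw [h3]
    exact h1
  have hF : (fun v => fiberNorm F (cosetProj H g) (τ v)) = localRep F (cosetOrigin H)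
      (extChartAt (𝓡 n) (cosetOrigin H) (cosetOrigin H)) := by
    funext v
    rw [localRep_self]
    refine Eq.trans (congrArg F ?_) (hinv g (cosetOrigin H) v)
    refine tangentBundle_mk_eq_iff.2 ⟨?_, rfl⟩
    exact congrArg (cosetProj H) (mul_one g).symm
  have hinj := mfderiv_extChartAt_injective hξ2
  rw [← hF, cartanTensor_comp_linearMap, hinj (hY.trans (hτ u).symm),
    hinj (hU.trans (hτ a).symm), hinj (hV.trans (hτ b).symm), hinj (hW.trans (hτ d).symm)]

/-- In frame components the Cartan tensor is that of one fixed norm, so only the components vary.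
The result involves `y` and `w` alone, and holds for every admissible geodesic and parallel fields.
-/
lemma IsOriginSection.hasDerivAt_cartanTensor_geodesic (hS : IsOriginSection H 𝔪 S)
    (hπ : ContMDiff 𝓘(ℝ, E) (𝓡 n) ∞ (cosetProj H))
    (hs : Manifold.IsSubmersionAt 𝓘(ℝ, E) (𝓡 n) ∞ (cosetProj H) 1) (hF : IsFinslerMetric F)
    (hinv : IsInvariantMetric F) {y w : TangentSpace (𝓡 n) (cosetOrigin H)} (hy : y ≠ 0)
    {c : ℝ → G ⧸ H} {U V W : ∀ t, TangentSpace (𝓡 n) (c t)} (hc : IsGeodesicAt F c 0)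
    (hcy : (⟨c 0, curveVelocity c 0⟩ : TangentBundle (𝓡 n) (G ⧸ H)) = ⟨cosetOrigin H, y⟩)
    (hU : IsLinearlyParallelAt F c U 0)
    (hU0 : (⟨c 0, U 0⟩ : TangentBundle (𝓡 n) (G ⧸ H)) = ⟨cosetOrigin H, w⟩)
    (hV : IsLinearlyParallelAt F c V 0)
    (hV0 : (⟨c 0, V 0⟩ : TangentBundle (𝓡 n) (G ⧸ H)) = ⟨cosetOrigin H, w⟩)
    (hW : IsLinearlyParallelAt F c W 0)
    (hW0 : (⟨c 0, W 0⟩ : TangentBundle (𝓡 n) (G ⧸ H)) = ⟨cosetOrigin H, w⟩)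
    {L : EuclideanSpace ℝ (Fin n) → EuclideanSpace ℝ (Fin n) → ℝ}
    (hL : localRep F (cosetOrigin H) = L) {x₀ y' w' : EuclideanSpace ℝ (Fin n)}
    (hx₀ : extChartAt (𝓡 n) (cosetOrigin H) (cosetOrigin H) = x₀) (hy' : y = y') (hw' : w = w') :
    HasDerivAt
      (fun t => cartanTensor (fiberNorm F (c t)) (curveVelocity c t) (U t) (V t) (W t))
      (3 * cartanTensor (L x₀) y' w' w' (-(connectionVec L x₀ y' w' + frameTorsion H S y' w'))
        - cartanTensor₄ (L x₀) y' w' w' w'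
          ((2 : ℝ) • sprayVec L x₀ y' + frameTorsion H S y' y')) 0 := by
  subst hL hx₀ hy' hw'
  have h0 := (tangentBundle_mk_eq_iff.1 hcy).1
  have hloc := hc.eventually_localCurve h0
  have hcv := deriv_localCurve_zero (hc.1.self_of_nhds.mdifferentiableAt (by simp)) hcy
  have hx0 : localCurve (n := n) (cosetOrigin H) c 0
      = extChartAt (𝓡 n) (cosetOrigin H) (cosetOrigin H) := by rw [localCurve, h0]
  have hx := (hloc.self_of_nhds.2.1.differentiableAt (by simp)).hasDerivAt
  have hxx := (hloc.self_of_nhds.2.1.differentiableAt_deriv).hasDerivAt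
  have hgeo := hloc.self_of_nhds.2.2.2
  obtain ⟨σ, hσ0, hσ, hσf⟩ := hS.exists_localSection hπ
  obtain ⟨ξ, hξ⟩ : ∃ ξ : ℝ → E, ξ = fun t => σ (localCurve (n := n) (cosetOrigin H) c t) := ⟨_, rfl⟩
  have hξ0 : ξ 0 = chartOne E G := by rw [hξ]; simp only [hx0, hσ0]
  have hξd : HasDerivAt ξ (S y) 0 := by
    rw [← hx0] at hσ
    have h1 := hσ.comp_hasDerivAt 0 hx
    rw [hcv] at h1
    rw [hξ]
    exact h1
  have hA := differentiableAt_cosetFrame (S := S) hπ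
  have hA0 := hS.cosetFrame_chartOne hπ
  have hinv0 : ∀ v, (cosetFrame H S (ξ 0)).inverse v = v := by
    intro v
    rw [hξ0, hA0, ContinuousLinearMap.inverse_id]
    rfl
  -- Components `a = A⁻¹ X` satisfy `a'(0) = X'(0) - B(y, w)`, and parallelism gives `X'(0) =
  -- -N_coord(w)`.
  have hfield : ∀ {X : ∀ t, TangentSpace (𝓡 n) (c t)}, IsLinearlyParallelAt F c X 0 →
      (⟨c 0, X 0⟩ : TangentBundle (𝓡 n) (G ⧸ H)) = ⟨cosetOrigin H, w⟩ →
      HasDerivAt (fun t => (cosetFrame H S (ξ t)).inverse (localField (cosetOrigin H) c X t))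
        (-(connectionVec (localRep F (cosetOrigin H))
          (extChartAt (𝓡 n) (cosetOrigin H) (cosetOrigin H)) y w + frameTorsion H S y w)) 0 ∧
      (cosetFrame H S (ξ 0)).inverse (localField (cosetOrigin H) c X 0) = w := by
    intro X hX hX0
    obtain ⟨h1, h2⟩ := hX.eventually_localField hX0
    obtain ⟨h3, h4⟩ := h2.self_of_nhds
    refine ⟨(hasDerivAt_frame_inverse hA hA0 hξd hξ0
      (h3.differentiableAt (by simp)).hasDerivAt).congr_deriv ?_, (hinv0 _).trans h1⟩
    rw [h1, hcv, hx0] at h4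
    rw [h1, eq_neg_of_add_eq_zero_left h4, neg_add, sub_eq_add_neg]
    rfl
  have hu := hasDerivAt_frame_inverse hA hA0 hξd hξ0 hxx
  -- The same computation for the velocity, with `ẍ = -2 G(y)`: the components have derivative
  -- `-η(y)`.
  have hu' := hu.congr_deriv (g' := -((2 : ℝ) • sprayVec (localRep F (cosetOrigin H))
      (extChartAt (𝓡 n) (cosetOrigin H) (cosetOrigin H)) y + frameTorsion H S y y)) (by
    rw [hcv, hx0] at hgeo
    rw [hcv, eq_neg_of_add_eq_zero_left hgeo, neg_add, sub_eq_add_neg]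
    rfl)
  have hLF := hF.isLocalFinsler (cosetOrigin H)
  have hmem := mem_extChartAt_target (I := 𝓡 n) (cosetOrigin H)
  have hmain := hasDerivAt_cartanTensor isOpen_compl_singleton (hLF.contDiffOn_fiber hmem)
    (show y ∈ ({0}ᶜ : Set (EuclideanSpace ℝ (Fin n))) from hy) hu' ((hinv0 _).trans hcv)
    (hfield hU hU0).1 (hfield hU hU0).2 (hfield hV hV0).1 (hfield hV hV0).2
    (hfield hW hW0).1 (hfield hW hW0).2
  have hneg := cartanTensor₄_neg isOpen_compl_singleton (hLF.contDiffOn_fiber hmem)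
    (show y ∈ ({0}ᶜ : Set (EuclideanSpace ℝ (Fin n))) from hy)
  refine (hmain.congr_of_eventuallyEq ?_).congr_deriv
    ((congrArg (_ + ·) (hneg _ _ _ _)).trans (sub_eq_add_neg _ _).symm)
  have hdom : ∀ᶠ t in 𝓝 (0 : ℝ), ξ t ∈ cosetDomain E H n :=
    hξd.continuousAt.eventually_mem ((isOpen_cosetDomain hπ).mem_nhds
      (by rw [hξ0]; exact chartOne_mem_cosetDomain))
  have hinvt : ∀ᶠ t in 𝓝 (0 : ℝ), (cosetFrame H S (ξ t)).IsInvertible := by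
    have h1 : ContinuousAt (cosetFrame H S) (ξ 0) := by rw [hξ0]; exact hA.continuousAt
    exact (h1.comp hξd.continuousAt).eventually_mem (isOpen_isInvertible.mem_nhds
      (show (cosetFrame H S (ξ 0)).IsInvertible by
        rw [hξ0, hA0]; exact ⟨ContinuousLinearEquiv.refl ℝ _, rfl⟩))
  have hft : ∀ᶠ t in 𝓝 (0 : ℝ), cosetCoord H n (ξ t) = localCurve (cosetOrigin H) c t := by
    rw [hξ]
    exact hx.continuousAt.eventually (by rw [hx0]; exact hσf)
  filter_upwards [hloc, hdom, hinvt, hft] with t ht hdt hit hft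
  refine hS.cartanTensor_fiberNorm_eq hπ hs hinv hdt ?_ ?_ ?_ ?_ ?_
  · exact (extChartAt (𝓡 n) (cosetOrigin H)).injOn hdt.2 ht.1 hft
  · rw [hit.apply_inverse_apply, ht.2.2.1.deriv]
  · rw [hit.apply_inverse_apply]; rfl
  · rw [hit.apply_inverse_apply]; rfl
  · rw [hit.apply_inverse_apply]; rfl

variable [FiniteDimensional ℝ E]

lemma IsOriginSection.exists_parallel_geodesic (hS : IsOriginSection H 𝔪 S)
    (hπ : ContMDiff 𝓘(ℝ, E) (𝓡 n) ∞ (cosetProj H)) (hF : IsFinslerMetric F)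
    {y w : TangentSpace (𝓡 n) (cosetOrigin H)} (hy : y ≠ 0) :
    ∃ (c : ℝ → G ⧸ H) (X : ∀ t, TangentSpace (𝓡 n) (c t)), IsGeodesicAt F c 0 ∧
      (⟨c 0, curveVelocity c 0⟩ : TangentBundle (𝓡 n) (G ⧸ H)) = ⟨cosetOrigin H, y⟩ ∧
      IsLinearlyParallelAt F c X 0 ∧
      (⟨c 0, X 0⟩ : TangentBundle (𝓡 n) (G ⧸ H)) = ⟨cosetOrigin H, w⟩ := by
  obtain ⟨x, X, ξ, hx0, hxy, hX0, -, hev⟩ := (hF.isLocalFinsler (cosetOrigin H)).exists_geodesic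
    (isOpen_cosetDomain hπ) (contDiffOn_cosetCoord hπ) (contDiffOn_leftFrame_comp (S := S))
    chartOne_mem_cosetDomain
    (by rw [cosetCoord_chartOne]; exact mem_extChartAt_target _)
    (hS.cosetFrame_chartOne hπ) hy w
  rw [cosetCoord_chartOne] at hx0
  have hcont : ContDiffAt ℝ ∞ x 0 := hev.self_of_nhds.2.2.1
  exact ⟨fun t => (extChartAt (𝓡 n) (cosetOrigin H)).symm (x t),
    fun t => mfderiv (𝓡 n) (𝓡 n) (extChartAt (𝓡 n) (cosetOrigin H)).symm (x t) (X t),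
    isGeodesicAt_extChartAt_symm hx0 (hev.mono fun t ht => ⟨ht.2.2.1, ht.2.2.2.2.2.1,
      ht.2.2.2.2.2.2.1⟩),
    curveVelocity_extChartAt_symm_zero hx0
      ((hcont.differentiableAt (by simp)).hasDerivAt.congr_deriv hxy),
    isLinearlyParallelAt_extChartAt_symm hx0 hcont.continuousAt
      (hev.mono fun t ht => ⟨ht.2.2.2.1, ht.2.2.2.2.2.2.2.1⟩),
    field_extChartAt_symm_zero hx0 hX0⟩

/-- Existence makes the value chosen by `Classical.epsilon` a genuine one, and uniqueness of
derivatives identifies it. As the three arguments coincide, one parallel field serves in all slots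
for existence. -/
lemma IsOriginSection.landsbergCurvature_eq (hS : IsOriginSection H 𝔪 S)
    (hπ : ContMDiff 𝓘(ℝ, E) (𝓡 n) ∞ (cosetProj H))
    (hs : Manifold.IsSubmersionAt 𝓘(ℝ, E) (𝓡 n) ∞ (cosetProj H) 1) (hF : IsFinslerMetric F)
    (hinv : IsInvariantMetric F) {y w : TangentSpace (𝓡 n) (cosetOrigin H)} (hy : y ≠ 0)
    {L : EuclideanSpace ℝ (Fin n) → EuclideanSpace ℝ (Fin n) → ℝ}
    (hL : localRep F (cosetOrigin H) = L) {x₀ y' w' : EuclideanSpace ℝ (Fin n)}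
    (hx₀ : extChartAt (𝓡 n) (cosetOrigin H) (cosetOrigin H) = x₀) (hy' : y = y') (hw' : w = w') :
    landsbergCurvature F (cosetOrigin H) y w w w
      = 3 * cartanTensor (L x₀) y' w' w' (-(connectionVec L x₀ y' w' + frameTorsion H S y' w'))
        - cartanTensor₄ (L x₀) y' w' w' w'
          ((2 : ℝ) • sprayVec L x₀ y' + frameTorsion H S y' y') := by
  have hex : ∃ ℓ, IsLandsbergValue F (cosetOrigin H) y w w w ℓ := by
    obtain ⟨c, X, hc, hcy, hX, hX0⟩ := hS.exists_parallel_geodesic hπ hF (w := w) hy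
    exact ⟨_, c, X, X, X, hc, hcy, hX, hX0, hX, hX0, hX, hX0,
      hS.hasDerivAt_cartanTensor_geodesic hπ hs hF hinv hy hc hcy hX hX0 hX hX0 hX hX0
        hL hx₀ hy' hw'⟩
  obtain ⟨c, U, V, W, hc, hcy, hU, hU0, hV, hV0, hW, hW0, hd⟩ := Classical.epsilon_spec hex
  exact hd.unique (hS.hasDerivAt_cartanTensor_geodesic hπ hs hF hinv hy hc hcy hU hU0 hV hV0 hW hW0
    hL hx₀ hy' hw')

end Landsberg

/-! ### Assembly of the formula on `𝔪` -/

theorem theorem6p4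
    {E : Type*} [NormedAddCommGroup E] [NormedSpace ℝ E] [FiniteDimensional ℝ E]
    {G : Type*} [Group G] [TopologicalSpace G] [ChartedSpace E G] [LieGroup 𝓘(ℝ, E) ∞ G]
    (H : Subgroup G) (hH : IsClosed (H : Set G))
    {n : ℕ} [ChartedSpace (EuclideanSpace ℝ (Fin n)) (G ⧸ H)] [IsManifold (𝓡 n) ∞ (G ⧸ H)]
    (hπ : Manifold.IsSubmersion 𝓘(ℝ, E) (𝓡 n) ∞ (cosetProj H))
    (F : TangentBundle (𝓡 n) (G ⧸ H) → ℝ) (hF : IsFinslerMetric F) (hinv : IsInvariantMetric F)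
    (𝔪 : Submodule ℝ (GroupLieAlgebra 𝓘(ℝ, E) G)) (h𝔪 : IsCompl 𝔪 (subgroupLieAlgebra H))
    (y w : 𝔪) (hy : y ≠ 0) :
    landsbergCurvature F (cosetOrigin H) (toTangentOrigin 𝔪 y)
        (toTangentOrigin 𝔪 w) (toTangentOrigin 𝔪 w) (toTangentOrigin 𝔪 w)
      = 3 * cartanTensor (originNorm F 𝔪) y w w
            (bracketProj h𝔪 w y - connectionOperator F h𝔪 y w)
        - cartanTensor₄ (originNorm F 𝔪) y w w w (sprayVectorField F 𝔪 y) := by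
  obtain ⟨S, hS⟩ := exists_isOriginSection hπ h𝔪
  have hs := hπ.isSubmersionAt 1
  have hy' : toTangentOrigin (n := n) (H := H) 𝔪 y ≠ 0 := fun h =>
    hy (hS.tangentOriginMap_injective (h.trans (map_zero (tangentOriginMap H 𝔪)).symm))
  have hnorm : originNorm F 𝔪 = fun v => localRep F (cosetOrigin H)
      (extChartAt (𝓡 n) (cosetOrigin H) (cosetOrigin H)) (tangentOriginMap H 𝔪 v) := by
    funext v
    rw [localRep_self]
    rfl
  -- The term `B(w, y)` of the bracket cancels the one in the connection operator, leaving the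
  -- derivative of the frame components of a parallel field.
  have h1 : tangentOriginMap H 𝔪 (bracketProj h𝔪 w y - connectionOperator F h𝔪 y w)
      = -(connectionVec (localRep F (cosetOrigin H))
          (extChartAt (𝓡 n) (cosetOrigin H) (cosetOrigin H)) (tangentOriginMap H 𝔪 y)
          (tangentOriginMap H 𝔪 w)
        + frameTorsion H S (tangentOriginMap H 𝔪 y) (tangentOriginMap H 𝔪 w)) := by
    rw [map_sub, hS.tangentOriginMap_bracketProj hπ.contMDiff hs,
      hS.tangentOriginMap_connectionOperator hπ.contMDiff hs hF h𝔪 hy]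
    abel
  rw [hnorm, cartanTensor_comp_linearMap, cartanTensor₄_comp_linearMap, h1,
    hS.tangentOriginMap_sprayVectorField hπ.contMDiff hF hy]
  exact hS.landsbergCurvature_eq hπ.contMDiff hs hF hinv hy' rfl rfl rfl rfl
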